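/- Let $a,b,c,d,e,f$ be independent variables over $\mathbb{Q}$, let $K=\mathbb{Q}(a,b,c,d,e,f)$, and consider the six points $A=[1,a,a^2],\ B=[1,b,b^2],\ \dots,\ F=[1,f,f^2]$ on the conic $z_1^2=z_0z_2$ in the projective plane over $K$. For an array $\left[\begin{smallmatrix} P_1&P_2&P_3\\ Q_1&Q_2&Q_3\end{smallmatrix}\right]$ in which each of the six points occurs once, its *Pascal* is the line containing the three collinear points $P_1Q_2\cap P_2Q_1$, $P_2Q_3\cap P_3Q_2$, $P_1Q_3\cap P_3Q_1$. Its line coordinates can be normalized to $\langle 1,s,t\rangle$ (the line $z_0+s z_1+t z_2=0$) with $s,t\in K$. For a set $X$ of Pascals let $K_X\subseteq K$ be the subfield generated over $\mathbb{Q}$ by the coordinates $s,t$ of all the lines in $X$. Call $X$ *adequate* if $K_X=K$, and *optimal* if it is adequate and no proper subset of $X$ is adequate. Let $$\ell_1=\left[\begin{smallmatrix}A&D&B\\E&C&F\end{smallmatrix}\right],\quad \ell_2=\left[\begin{smallmatrix}A&C&F\\E&D&B\end{smallmatrix}\right],\quad \ell_3=\left[\begin{smallmatrix}A&D&F\\E&C&B\end{smallmatrix}\right],\quad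 \ell_*=\left[\begin{smallmatrix}A&B&C\\F&D&E\end{smallmatrix}\right]$$ denote the Pascals of these arrays. **Proposition.** The set $\{\ell_1,\ell_2,\ell_3,\ell_*\}$ is optimal. Moreover $[K:K_X]=2$ for $X=\{\ell_1,\ell_2,\ell_3\}$, and $[K:K_X]=12$ for each of $X=\{\ell_1,\ell_2,\ell_*\}$, $X=\{\ell_1,\ell_3,\ell_*\}$ and $X=\{\ell_2,\ell_3,\ell_*\}$. -/

import Mathlib

namespace PascalHexagram

/-- Names of the six points on the conic. -/
inductive Letter
  | A | B | C | D | E | F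
  deriving DecidableEq

instance : Fintype Letter where
  elems := {.A, .B, .C, .D, .E, .F}
  complete := fun p => by cases p <;> simp

/-- The point `[1, r, r ^ 2]` of the conic `z₁ ^ 2 = z₀ * z₂`, in homogeneous coordinates. -/
def conicPoint {R : Type*} [CommRing R] (r : R) : Fin 3 → R :=
  ![1, r, r ^ 2]

/-- Line coordinates of the line joining two points of the plane. -/
def join {R : Type*} [CommRing R] (P Q : Fin 3 → R) : Fin 3 → R :=
  crossProduct P Q

/-- Point coordinates of the intersection of two lines of the plane. -/
def meet {R : Type*} [CommRing R] (l m : Fin 3 → R) : Fin 3 → R :=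
  crossProduct l m

/-- The cross-hair intersection of columns `i` and `j` of an array: the top entry of column `i` is
joined to the bottom entry of column `j`, and vice versa. The letter `p` stands for the
point `[1, x p, (x p) ^ 2]`. -/
def crossHair {R : Type*} [CommRing R] (x : Letter → R) (M : Matrix (Fin 2) (Fin 3) Letter)
    (i j : Fin 3) : Fin 3 → R :=
  meet (join (conicPoint (x (M 0 i))) (conicPoint (x (M 1 j))))
    (join (conicPoint (x (M 0 j))) (conicPoint (x (M 1 i))))

/-- Homogeneous line coordinates of the Pascal of an array. It is defined as the join of two
cross-hair intersections; it contains the third one by `pascal_theorem` below. -/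
def pascalLine {R : Type*} [CommRing R] (x : Letter → R) (M : Matrix (Fin 2) (Fin 3) Letter) :
    Fin 3 → R :=
  join (crossHair x M 0 1) (crossHair x M 1 2)

/-- All three cross-hair intersections of an array lie on its Pascal. -/
theorem pascal_theorem {R : Type*} [CommRing R] (x : Letter → R)
    (M : Matrix (Fin 2) (Fin 3) Letter) :
    pascalLine x M ⬝ᵥ crossHair x M 0 1 = 0 ∧
    pascalLine x M ⬝ᵥ crossHair x M 1 2 = 0 ∧
    pascalLine x M ⬝ᵥ crossHair x M 0 2 = 0 := by
  refine ⟨?_, ?_, ?_⟩ <;>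
  · simp only [pascalLine, crossHair, join, meet, conicPoint, cross_apply, dotProduct,
      Fin.sum_univ_three, Matrix.cons_val_zero, Matrix.cons_val_one, Matrix.cons_val]
    ring

/-- The field `ℚ(a, …, f)` of rational functions in six independent variables. -/
abbrev RatFun : Type :=
  FractionRing (MvPolynomial Letter ℚ)

/-- The six independent variables `a, …, f`, as elements of `ℚ(a, …, f)`. -/
noncomputable def coord (p : Letter) : RatFun :=
  algebraMap (MvPolynomial Letter ℚ) RatFun (MvPolynomial.X p)

/-- The line coordinates `⟨1, s, t⟩` of the Pascal of an array of the points
`A = [1, a, a ^ 2], …, F = [1, f, f ^ 2]`. The divisor is nonzero, by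
`pascalLine_coord_ne_zero` below, whenever each letter occurs once in the array. -/
noncomputable def pascal (M : Matrix (Fin 2) (Fin 3) Letter) : Fin 3 → RatFun :=
  ![1, pascalLine coord M 1 / pascalLine coord M 0, pascalLine coord M 2 / pascalLine coord M 0]

theorem pascalLine_map {R S : Type*} [CommRing R] [CommRing S] (φ : R →+* S) (x : Letter → R)
    (M : Matrix (Fin 2) (Fin 3) Letter) (k : Fin 3) :
    pascalLine (fun p => φ (x p)) M k = φ (pascalLine x M k) := by
  fin_cases k <;>
  simp [pascalLine, crossHair, join, meet, conicPoint, cross_apply]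

theorem pascalLine_coord_ne_zero (M : Matrix (Fin 2) (Fin 3) Letter)
    (hM : Function.Bijective (fun q : Fin 2 × Fin 3 => M q.1 q.2)) :
    pascalLine coord M 0 ≠ 0 := by
  intro h
  have h1 : pascalLine (fun p => (MvPolynomial.X p : MvPolynomial Letter ℚ)) M 0 = 0 := by
    apply IsFractionRing.injective (MvPolynomial Letter ℚ) RatFun
    rw [map_zero, ← h]
    exact (pascalLine_map (algebraMap (MvPolynomial Letter ℚ) RatFun) _ M 0).symm
  let e := Equiv.ofBijective _ hM
  let w : Fin 2 × Fin 3 → ℚ := fun q => (![![7, -3, 2], ![1, -4, 5]] : Fin 2 → Fin 3 → ℚ) q.1 q.2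
  have h2 := pascalLine_map (MvPolynomial.eval (fun p => w (e.symm p)))
    (fun p => (MvPolynomial.X p : MvPolynomial Letter ℚ)) M 0
  rw [h1, map_zero] at h2
  simp only [MvPolynomial.eval_X] at h2
  have h3 : ∀ i j, w (e.symm (M i j)) = w (i, j) := fun i j => by
    congr 1
    exact e.symm_apply_apply (i, j)
  simp only [pascalLine, crossHair, join, meet, conicPoint, cross_apply, h3, w,
    Matrix.cons_val_zero, Matrix.cons_val_one, Matrix.cons_val] at h2
  norm_num at h2

open Letter in
/-- The Pascal `ℓ₁`. -/
noncomputable def line1 : Fin 3 → RatFun := pascal !![A, D, B; E, C, F]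

open Letter in
/-- The Pascal `ℓ₂`. -/
noncomputable def line2 : Fin 3 → RatFun := pascal !![A, C, F; E, D, B]

open Letter in
/-- The Pascal `ℓ₃`. -/
noncomputable def line3 : Fin 3 → RatFun := pascal !![A, D, F; E, C, B]

open Letter in
/-- The Pascal `ℓ⋆`. -/
noncomputable def lineStar : Fin 3 → RatFun := pascal !![A, B, C; F, D, E]

/-- The subfield of `ℚ(a, …, f)` generated over `ℚ` by the coordinates `s` and `t` of the lines
`⟨1, s, t⟩` in `X`. -/
noncomputable def fieldOf (X : Set (Fin 3 → RatFun)) : IntermediateField ℚ RatFun :=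
  IntermediateField.adjoin ℚ {y | ∃ l ∈ X, y = l 1 ∨ y = l 2}

/-- A set of Pascals is adequate if its coordinates generate all of `ℚ(a, …, f)`. -/
def IsAdequate (X : Set (Fin 3 → RatFun)) : Prop :=
  fieldOf X = ⊤

/-- A set of Pascals is optimal if it is adequate and no proper subset of it is adequate. -/
def IsOptimal (X : Set (Fin 3 → RatFun)) : Prop :=
  IsAdequate X ∧ ∀ Y, Y ⊂ X → ¬ IsAdequate Y

end PascalHexagram

/-! Any two of `ℓ₁`, `ℓ₂`, `ℓ₃` share a cross-hair intersection, and the three points BC∩DF, CA∩DE,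
AB∩EF so obtained are the meets of corresponding sides of the inscribed triangles ABC and EFD. A
vertex of an inscribed triangle whose sides pass through three given points satisfies a quadratic
equation (`vertex_quadratic`), and `a` and `e` are its two roots. So `a` is at most quadratic over
the field of the three lines and generates everything (`coord_A_quadratic`). The permutation
`rowSwap` exchanges the rows of all three arrays, so it fixes that field but moves `a`, and the
degree is exactly 2. It also moves `ℓ⋆`; as 2 is prime, adding `ℓ⋆` gives the whole field.

For `{ℓ₁, ℓ₂, ℓ⋆}`, let [1, u, v] = BC∩DF be the point common to `ℓ₁` and `ℓ₂`. Projection from it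
is an involution of the conic that exchanges B with C and D with F; its fixed points have parameters
u ± r with r² = u² − v. This element lies in the field of the lines and is not a square in K, so
adjoining r to both fields leaves the degree unchanged (`finrank_eq_of_quadratic_extension`). Moving
the fixed points to 0 and ∞ turns the involution into x ↦ −x, hence c = −b and f = −d. Now `ℓ₁` and
`ℓ₂` have one parameter each, m₁ and m₂, and `ℓ⋆` has two, g and h. What remains is the degree of
ℚ(u, r, a, b, d, e) over ℚ(u, r, m₁, m₂, g, h).

The ratio y = (b + d + e − a)/(a + b + d − e) generates this extension, and elimination of b + d
shows that y is a root of `fiberPoly`, of degree 12 (`hexagon_fiber`). Since the extension is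
algebraic, u, r, m₁, m₂, g, h are algebraically independent, so irreducibility of `fiberPoly` may be
tested at one rational point, and there modulo 7. The permutation `rotation`, which cycles `ℓ₁`,
`ℓ₂`, `ℓ₃` and fixes `ℓ⋆`, carries the result to the other two triples. Optimality follows because
each proper subset lies in one of the four triples. -/

namespace PascalHexagram

/-! ### Gauss's lemma under reduction, and degrees of simple extensions. -/

section FieldTheory

open Polynomial

/-- A polynomial over a unique factorization domain whose image over some field is irreducible of
the same degree is irreducible over the fraction field. -/
theorem irreducible_map_algebraMap_of_irreducible_map {R K k : Type*} [CommRing R] [IsDomain R]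
    [UniqueFactorizationMonoid R] [Field K] [Algebra R K] [IsFractionRing R K] [Field k]
    (φ : R →+* k) (f : R[X]) (hdeg : f.natDegree ≤ (f.map φ).natDegree)
    (hirr : Irreducible (f.map φ)) : Irreducible (f.map (algebraMap R K)) := by
  obtain ⟨_⟩ := (inferInstance : Nonempty (NormalizationMonoid R))
  let _ : NormalizedGCDMonoid R := UniqueFactorizationMonoid.toNormalizedGCDMonoid R
  have hf0 : f ≠ 0 := by rintro rfl; simp at hirr
  have hc0 : f.content ≠ 0 := by rwa [Ne, content_eq_zero_iff]
  have hprim : Irreducible f.primPart := by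
    have hfac : f.map φ = C (φ f.content) * f.primPart.map φ := by
      conv_lhs => rw [f.eq_C_content_mul_primPart]
      simp
    have hφc : φ f.content ≠ 0 := by
      intro h
      rw [hfac, h] at hirr
      simp at hirr
    have hirr' : Irreducible (f.primPart.map φ) := by
      rw [hfac] at hirr
      exact (irreducible_isUnit_mul (isUnit_C.mpr hφc.isUnit)).mp hirr
    have hdeg' : f.primPart.natDegree ≤ (f.primPart.map φ).natDegree := by
      rw [hfac, natDegree_C_mul hφc] at hdeg
      rwa [natDegree_primPart]
    -- The degree bound leaves no room for a factor of positive degree whose image is a unit; a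
    -- constant factor of a primitive polynomial is a unit.
    have hunit : ∀ a b : R[X], f.primPart = a * b → IsUnit (a.map φ) → IsUnit a := by
      intro a b hab ha
      have hb0 : a * b ≠ 0 := hab ▸ f.primPart_ne_zero
      have h1 : (f.primPart.map φ).natDegree = (b.map φ).natDegree := by
        have h0 : a.map φ ≠ 0 := ha.ne_zero
        have h0' : b.map φ ≠ 0 := by
          rintro h
          rw [hab, Polynomial.map_mul, h, mul_zero] at hirr'
          simp at hirr'
        rw [hab, Polynomial.map_mul, natDegree_mul h0 h0', natDegree_eq_zero_of_isUnit ha, zero_add]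
      have h2 : a.natDegree + b.natDegree ≤ b.natDegree := by
        calc a.natDegree + b.natDegree = f.primPart.natDegree := by
              rw [hab, natDegree_mul (left_ne_zero_of_mul hb0) (right_ne_zero_of_mul hb0)]
          _ ≤ (b.map φ).natDegree := h1 ▸ hdeg'
          _ ≤ b.natDegree := natDegree_map_le
      have h3 : a = C (a.coeff 0) := eq_C_of_natDegree_eq_zero (by omega)
      rw [h3]
      exact (f.isPrimitive_primPart _ (h3 ▸ Dvd.intro _ hab.symm)).map C
    refine ⟨fun h => hirr'.not_isUnit (h.map (mapRingHom φ)), fun {a b} hab => ?_⟩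
    rcases hirr'.isUnit_or_isUnit (by rw [hab, Polynomial.map_mul]) with h | h
    · exact Or.inl (hunit a b hab h)
    · exact Or.inr (hunit b a (by rw [hab, mul_comm]) h)
  rw [f.isPrimitive_primPart.irreducible_iff_irreducible_map_fraction_map (K := K)] at hprim
  rw [f.eq_C_content_mul_primPart, Polynomial.map_mul, map_C]
  refine (irreducible_isUnit_mul (isUnit_C.mpr ?_)).mpr hprim
  exact ((map_ne_zero_iff _ (IsFractionRing.injective R K)).mpr hc0).isUnit

variable {k L : Type*} [Field k] [Field L] [Algebra k L]

/-- Degree of a simple extension of an intermediate field, read off from an irreducible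
polynomial. -/
theorem relfinrank_sup_adjoin_of_irreducible (A : IntermediateField k L) (f : A[X])
    (hf : Irreducible f) (α : L) (hα : aeval α f = 0) :
    A.relfinrank (A ⊔ IntermediateField.adjoin k {α}) = f.natDegree := by
  have hint : IsIntegral A α :=
    (isAlgebraic_iff_isIntegral.mp ⟨f, hf.ne_zero, hα⟩)
  have h1 : Module.finrank A (IntermediateField.adjoin A {α}) = f.natDegree := by
    rw [IntermediateField.adjoin.finrank hint, ← minpoly.eq_of_irreducible hf hα,
      natDegree_mul_leadingCoeff_inv _ hf.ne_zero]
  have hle : A ≤ A ⊔ IntermediateField.adjoin k {α} := le_sup_left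
  have h2 : IntermediateField.extendScalars hle = IntermediateField.adjoin A {α} :=
    IntermediateField.restrictScalars_injective k
      (IntermediateField.restrictScalars_adjoin_eq_sup k A {α}).symm
  rw [IntermediateField.relfinrank_eq_finrank_of_le hle, h2, h1]

theorem relfinrank_sup_adjoin_of_quadratic (A : IntermediateField k L) (α p q : L) (hp : p ∈ A)
    (hq : q ∈ A) (h : α * α + p * α + q = 0) (hα : α ∉ A) :
    A.relfinrank (A ⊔ IntermediateField.adjoin k {α}) = 2 := by
  let f : A[X] := X ^ 2 + C ⟨p, hp⟩ * X + C ⟨q, hq⟩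
  have hdeg : f.natDegree = 2 := by
    unfold f
    compute_degree
    · exact one_ne_zero
    · norm_num
  rw [← hdeg]
  refine relfinrank_sup_adjoin_of_irreducible A f ?_ α ?_
  · refine irreducible_of_degree_le_three_of_not_isRoot (by simp [hdeg]) fun x hx => ?_
    have hx' : (x : L) * x + p * x + q = 0 := by
      have := congrArg (algebraMap A L) hx
      simpa [f, sq] using this
    have h0 : (α - x) * (α + x + p) = 0 := by linear_combination h - hx'
    rcases mul_eq_zero.mp h0 with h1 | h1
    · exact hα (by rw [sub_eq_zero.mp h1]; exact x.2)
    · exact hα (by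
        rw [show α = -(x + p) by linear_combination h1]
        exact A.neg_mem (A.add_mem x.2 hp))
  · have : aeval α f = α ^ 2 + p * α + q := by simp [f]
    rw [this]
    linear_combination h

end FieldTheory

/-! ### Nonvanishing and irreducibility tested at a rational point. -/

section Specialization

open MvPolynomial

variable {ι k L : Type*} [Field k] [Field L] [Algebra k L]

/-- A family over which `L` is algebraic contains a transcendence basis, and this one has no element
to spare. -/
theorem algebraicIndependent_of_isAlgebraic_adjoin [Fintype ι] (x : ι → L)
    (htr : Algebra.trdeg k L = Fintype.card ι)
    [Algebra.IsAlgebraic (IntermediateField.adjoin k (Set.range x)) L] :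
    AlgebraicIndependent k x := by
  have : Algebra.IsAlgebraic (Algebra.adjoin k (Set.range x)) L := by
    refine ⟨fun z => ?_⟩
    exact IntermediateField.isAlgebraic_adjoin_iff.mp (Algebra.IsAlgebraic.isAlgebraic z)
  refine (Algebra.IsAlgebraic.isTranscendenceBasis_of_lift_le_trdeg_of_finite k x ?_).1
  rw [htr]
  simp

/-- `HasVal x pt z q` says that `z` is a quotient of polynomials in the elements `x i` which is
regular at the point `pt` and has the value `q` there. -/
def HasVal (x : ι → L) (pt : ι → k) (z : L) (q : k) : Prop :=
  ∃ n d : MvPolynomial ι k, eval pt d ≠ 0 ∧ z * aeval x d = aeval x n ∧ q * eval pt d = eval pt n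

namespace HasVal

variable {x : ι → L} {pt : ι → k} {z w : L} {q p : k}

/-- All genericity conditions below are proved this way: by independence, a vanishing quotient has
numerator zero as a polynomial, so it would have the value zero at every point where it is regular.
-/
theorem ne_zero (hx : AlgebraicIndependent k x) (h : HasVal x pt z q) (hq : q ≠ 0) : z ≠ 0 := by
  obtain ⟨n, d, hd, h1, h2⟩ := h
  rintro rfl
  rw [zero_mul] at h1
  have h3 : n = 0 := hx (by simpa using h1.symm)
  rw [h3, map_zero] at h2
  exact mul_ne_zero hq hd h2

theorem const (c : k) : HasVal x pt (algebraMap k L c) c :=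
  ⟨C c, 1, by simp, by simp, by simp⟩

theorem one : HasVal x pt 1 1 := by simpa using const (x := x) (pt := pt) 1

theorem var (i : ι) : HasVal x pt (x i) (pt i) := ⟨X i, 1, by simp, by simp, by simp⟩

theorem add (h : HasVal x pt z q) (h' : HasVal x pt w p) : HasVal x pt (z + w) (q + p) := by
  obtain ⟨n, d, hd, h1, h2⟩ := h
  obtain ⟨n', d', hd', h1', h2'⟩ := h'
  refine ⟨n * d' + n' * d, d * d', by simpa using ⟨hd, hd'⟩, ?_, ?_⟩
  · simp only [map_mul, map_add]; linear_combination aeval x d' * h1 + aeval x d * h1'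
  · simp only [map_mul, map_add]; linear_combination eval pt d' * h2 + eval pt d * h2'

theorem neg (h : HasVal x pt z q) : HasVal x pt (-z) (-q) := by
  obtain ⟨n, d, hd, h1, h2⟩ := h
  refine ⟨-n, d, hd, ?_, ?_⟩
  · simp only [map_neg]; linear_combination -h1
  · simp only [map_neg]; linear_combination -h2

theorem sub (h : HasVal x pt z q) (h' : HasVal x pt w p) : HasVal x pt (z - w) (q - p) := by
  simpa [sub_eq_add_neg] using h.add h'.neg

theorem mul (h : HasVal x pt z q) (h' : HasVal x pt w p) : HasVal x pt (z * w) (q * p) := by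
  obtain ⟨n, d, hd, h1, h2⟩ := h
  obtain ⟨n', d', hd', h1', h2'⟩ := h'
  refine ⟨n * n', d * d', by simpa using ⟨hd, hd'⟩, ?_, ?_⟩
  · simp only [map_mul, ← h1, ← h1']; ring
  · simp only [map_mul, ← h2, ← h2']; ring

theorem pow (h : HasVal x pt z q) (n : ℕ) : HasVal x pt (z ^ n) (q ^ n) := by
  induction n with
  | zero => simpa using one (x := x) (pt := pt)
  | succ n ih => simpa [pow_succ] using ih.mul h

/-- Gives the value of a quantity known only through an equation `z * w = v`, which is how the
parameters of the lines are given later. -/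
theorem of_mul_eq (hx : AlgebraicIndependent k x) (h' : HasVal x pt w p) (hp : p ≠ 0) {v : L}
    {r : k} (h : HasVal x pt v r) (e : z * w = v) : HasVal x pt z (r / p) := by
  have hw := h'.ne_zero hx hp
  obtain ⟨n, d, hd, h1, h2⟩ := h
  obtain ⟨n', d', hd', h1', h2'⟩ := h'
  have hn' : eval pt n' ≠ 0 := h2' ▸ mul_ne_zero hp hd'
  refine ⟨n * d', d * n', by simpa using ⟨hd, hn'⟩, ?_, ?_⟩
  · simp only [map_mul, ← h1, ← h1', ← e]; ring
  · simp only [map_mul, ← h2, ← h2']; field_simp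

theorem div (hx : AlgebraicIndependent k x) (h : HasVal x pt z q) (h' : HasVal x pt w p)
    (hp : p ≠ 0) : HasVal x pt (z / w) (q / p) :=
  of_mul_eq hx h' hp h (div_mul_cancel₀ _ (h'.ne_zero hx hp))

end HasVal

/-- A polynomial with coefficients in `k[x]`, for algebraically independent `x`, is irreducible over
`k(x)` if some specialization of the `x i` to rational numbers is irreducible and keeps the
degree. -/
theorem irreducible_of_specialization {x : ι → L} (hx : AlgebraicIndependent k x)
    (A : IntermediateField k L) (hA : IntermediateField.adjoin k (Set.range x) = A)
    (f : Polynomial (MvPolynomial ι k)) (ψ : MvPolynomial ι k →+* A)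
    (hψ : ∀ p, (ψ p : L) = aeval x p) (pt : ι → k)
    (hdeg : f.natDegree ≤ (f.map (eval pt)).natDegree) (hirr : Irreducible (f.map (eval pt))) :
    Irreducible (f.map ψ) := by
  subst hA
  have h := irreducible_map_algebraMap_of_irreducible_map
    (K := FractionRing (MvPolynomial ι k)) (eval pt) f hdeg hirr
  have h2 := (MulEquiv.irreducible_iff (Polynomial.mapEquiv hx.aevalEquivField.toRingEquiv)).mpr h
  convert h2 using 1
  rw [Polynomial.mapEquiv_apply, Polynomial.map_map]
  congr 1
  refine RingHom.ext fun p => Subtype.ext ?_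
  rw [hψ]
  exact (hx.aevalEquivField_algebraMap_apply_coe p).symm

end Specialization

/-! ### The polynomial of degree 12. -/

section FiberPolynomial

variable {R S : Type*} [CommRing R] [CommRing S]

/-- First building block of `fiberPoly`. -/
def polyQ (y m₁ m₂ h : R) : R :=
  (-m₁ ^ 5 * h ^ 4 + 4 * m₁ ^ 4 * h ^ 3 - 6 * m₁ ^ 3 * h ^ 2 + 4 * m₁ ^ 2 * h - m₁) * y ^ 6 +
    (-m₁ ^ 5 * h ^ 4 - 4 * m₁ ^ 4 * m₂ * h ^ 4 - 3 * m₁ ^ 4 * h ^ 3 - m₁ ^ 3 * m₂ * h ^ 3 +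
    m₁ ^ 3 * h ^ 2 + m₁ ^ 2 * m₂ * h ^ 2 - m₁ ^ 2 * h - 3 * m₁ * m₂ * h - 4 * m₁ - m₂) * y ^ 5 +
    (5 * m₁ ^ 4 * m₂ * h ^ 4 + 2 * m₁ ^ 4 * h ^ 3 + 8 * m₁ ^ 3 * m₂ ^ 2 * h ^ 4 +
    4 * m₁ ^ 3 * h ^ 2 - 6 * m₁ ^ 2 * m₂ ^ 2 * h ^ 3 + 6 * m₁ ^ 2 * m₂ * h ^ 2 - 6 * m₁ ^ 2 * h +
    4 * m₁ * m₂ ^ 2 * h ^ 2 + 8 * m₁ + 2 * m₂ ^ 2 * h + 5 * m₂) * y ^ 4 +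
    (-m₁ ^ 3 * m₂ ^ 2 * h ^ 4 - 5 * m₁ ^ 3 * m₂ * h ^ 3 + m₁ ^ 2 * m₂ ^ 3 * h ^ 4 +
    5 * m₁ ^ 2 * h + 5 * m₁ * m₂ ^ 3 * h ^ 3 + m₁ - 5 * m₂ ^ 2 * h - m₂) * y ^ 3 +
    (-8 * m₁ ^ 2 * m₂ ^ 3 * h ^ 4 + 6 * m₁ ^ 2 * m₂ ^ 2 * h ^ 3 - 4 * m₁ ^ 2 * m₂ * h ^ 2 -
    2 * m₁ ^ 2 * h - 5 * m₁ * m₂ ^ 4 * h ^ 4 - 6 * m₁ * m₂ ^ 2 * h ^ 2 - 5 * m₁ -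
    2 * m₂ ^ 4 * h ^ 3 - 4 * m₂ ^ 3 * h ^ 2 + 6 * m₂ ^ 2 * h - 8 * m₂) * y ^ 2 +
    (4 * m₁ * m₂ ^ 4 * h ^ 4 + m₁ * m₂ ^ 3 * h ^ 3 - m₁ * m₂ ^ 2 * h ^ 2 + 3 * m₁ * m₂ * h + m₁ +
    m₂ ^ 5 * h ^ 4 + 3 * m₂ ^ 4 * h ^ 3 - m₂ ^ 3 * h ^ 2 + m₂ ^ 2 * h + 4 * m₂) * y +
    (m₂ ^ 5 * h ^ 4 - 4 * m₂ ^ 4 * h ^ 3 + 6 * m₂ ^ 3 * h ^ 2 - 4 * m₂ ^ 2 * h + m₂)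

/-- Second building block of `fiberPoly`. -/
def polyC (y m₁ m₂ h : R) : R :=
  (m₁ ^ 3 * h ^ 2 - 2 * m₁ ^ 2 * h + m₁) * y ^ 4 + (m₁ ^ 2 * m₂ * h ^ 2 + m₁ ^ 2 * h +
    m₁ * m₂ * h + m₁) * y ^ 3 + (-2 * m₁ ^ 2 * m₂ * h ^ 2 - 2 * m₁ * m₂ ^ 2 * h ^ 2 - 2 * m₁ -
    2 * m₂) * y ^ 2 + (m₁ * m₂ ^ 2 * h ^ 2 + m₁ * m₂ * h + m₂ ^ 2 * h + m₂) * y + (m₂ ^ 3 * h ^ 2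
    - 2 * m₂ ^ 2 * h + m₂)

/-- Third building block of `fiberPoly`. -/
def polyW (y m₁ m₂ h : R) : R :=
  (2 * m₁ ^ 2 * h - 2 * m₁) * y ^ 3 + (-m₁ ^ 2 * h - m₁ * m₂ * h + m₁ + m₂) * y ^ 2 +
    (-m₁ * m₂ * h + m₁ - m₂ ^ 2 * h + m₂) * y + (2 * m₂ ^ 2 * h - 2 * m₂)

/-- Fourth building block of `fiberPoly`. -/
def polyT (y m₁ m₂ h : R) : R :=
  (-3 * m₁ ^ 3 * h ^ 2 + 2 * m₁ ^ 2 * h - 3 * m₁) * y ^ 4 + (3 * m₁ ^ 2 * m₂ * h ^ 2 +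
    3 * m₁ * m₂ ^ 2 * h ^ 2 - 4 * m₁ * m₂ * h + 3 * m₁ + 3 * m₂) * y ^ 2 + (-3 * m₂ ^ 3 * h ^ 2 +
    2 * m₂ ^ 2 * h - 3 * m₂)

/-- Fifth building block of `fiberPoly`. -/
def polyU (y m₁ m₂ h : R) : R :=
  (-m₁ ^ 4 * h ^ 3 + m₁ ^ 3 * h ^ 2 - m₁ ^ 2 * h + m₁) * y ^ 5 + (m₁ ^ 3 * h ^ 2 +
    m₁ ^ 2 * m₂ * h ^ 2 - m₁ ^ 2 * h - m₁ * m₂ * h) * y ^ 4 + (m₁ ^ 3 * m₂ * h ^ 3 -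
    2 * m₁ ^ 2 * m₂ * h ^ 2 + m₁ ^ 2 * h - m₁ * m₂ ^ 2 * h ^ 2 + 2 * m₁ * m₂ * h - m₂) * y ^ 3 +
    (-m₁ ^ 2 * m₂ * h ^ 2 + m₁ * m₂ ^ 3 * h ^ 3 - 2 * m₁ * m₂ ^ 2 * h ^ 2 + 2 * m₁ * m₂ * h - m₁
    + m₂ ^ 2 * h) * y ^ 2 + (m₁ * m₂ ^ 2 * h ^ 2 - m₁ * m₂ * h + m₂ ^ 3 * h ^ 2 - m₂ ^ 2 * h) * y
    + (-m₂ ^ 4 * h ^ 3 + m₂ ^ 3 * h ^ 2 - m₂ ^ 2 * h + m₂)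

/-- The polynomial of degree `12` in `y` whose roots parametrize the hexagons having three given
lines as Pascals, see `hexagon_fiber`. -/
def fiberPoly (y m₁ m₂ g h : R) : R :=
  (polyQ y m₁ m₂ h - (m₂ - m₁ * y ^ 2) * g ^ 2 * polyC y m₁ m₂ h) ^ 2 +
    g ^ 2 * polyW y m₁ m₂ h * (polyT y m₁ m₂ h + (m₂ - m₁ * y ^ 2) ^ 2 * g ^ 2) *
      polyU y m₁ m₂ h

theorem map_fiberPoly (φ : R →+* S) (y m₁ m₂ g h : R) :
    φ (fiberPoly y m₁ m₂ g h) = fiberPoly (φ y) (φ m₁) (φ m₂) (φ g) (φ h) := by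
  simp only [fiberPoly, polyQ, polyC, polyW, polyT, polyU, map_add, map_sub, map_mul, map_pow,
    map_neg, map_ofNat]

open Polynomial in
-- The bound comes from 2 · max(6, 2 + 0 + 4) for the square and 0 + 3 + 4 + 5 for the product. A
-- specialization of degree 12 then makes the degree exact.
theorem natDegree_fiberPoly_le (m₁ m₂ g h : R) :
    (fiberPoly X (C m₁) (C m₂) (C g) (C h)).natDegree ≤ 12 := by
  have hQ : (polyQ X (C m₁) (C m₂) (C h)).natDegree ≤ 6 := by
    unfold polyQ
    compute_degree!
  have hC : (polyC X (C m₁) (C m₂) (C h)).natDegree ≤ 4 := by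
    unfold polyC
    compute_degree!
  have hW : (polyW X (C m₁) (C m₂) (C h)).natDegree ≤ 3 := by
    unfold polyW
    compute_degree!
  have hT : (polyT X (C m₁) (C m₂) (C h)).natDegree ≤ 4 := by
    unfold polyT
    compute_degree!
  have hU : (polyU X (C m₁) (C m₂) (C h)).natDegree ≤ 5 := by
    unfold polyU
    compute_degree!
  have hK : (C m₂ - C m₁ * X ^ 2 : R[X]).natDegree ≤ 2 := by compute_degree!
  have hg : ((C g) ^ 2 : R[X]).natDegree ≤ 0 := by compute_degree!
  unfold fiberPoly
  refine natDegree_add_le_of_degree_le (natDegree_pow_le_of_le 2 (m := 6) ?_) ?_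
  · exact natDegree_sub_le_of_le hQ
      (natDegree_mul_le_of_le (natDegree_mul_le_of_le hK hg) hC)
  · exact natDegree_mul_le_of_le (natDegree_mul_le_of_le (natDegree_mul_le_of_le hg hW)
      (natDegree_add_le_of_degree_le hT
        (natDegree_mul_le_of_le (natDegree_pow_le_of_le 2 hK) hg))) hU

end FiberPolynomial

/-! ### Irreducibility of one specialization, by reduction modulo 7. -/

section ModSeven

open Polynomial

/-- A polynomial over a finite prime field of degree `n` is irreducible if, for all `d` with
`1 ≤ d ≤ n / 2`, none of its roots in extension fields is fixed by the `d`-th power of the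
Frobenius map. -/
theorem irreducible_of_pow_ne {p : ℕ} [Fact p.Prime] (f : (ZMod p)[X]) (hf : f.Monic)
    (hf1 : f ≠ 1)
    (h : ∀ (E : Type) [Field E] [Algebra (ZMod p) E] (α : E), aeval α f = 0 →
      ∀ d ∈ Finset.Ioc 0 (f.natDegree / 2), α ^ p ^ d ≠ α) : Irreducible f := by
  rw [hf.irreducible_iff_lt_natDegree_lt hf1]
  intro q hq hd hqf
  have hq1 : ¬ IsUnit q := fun hu => by
    have := natDegree_eq_zero_of_isUnit hu
    simp [this] at hd
  obtain ⟨r, hr, hrq⟩ := WfDvdMonoid.exists_irreducible_factor hq1 hq.ne_zero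
  have : Fact (Irreducible r) := ⟨hr⟩
  have hrd : r.natDegree ∈ Finset.Ioc 0 (f.natDegree / 2) := by
    have h1 := natDegree_le_of_dvd hrq hq.ne_zero
    have h2 := hr.natDegree_pos
    simp only [Finset.mem_Ioc] at hd ⊢
    omega
  have hroot : ∀ s : (ZMod p)[X], r ∣ s → aeval (AdjoinRoot.root r) s = 0 := by
    intro s hs
    rw [AdjoinRoot.aeval_eq, AdjoinRoot.mk_eq_zero]
    exact hs
  -- A factor of degree d ≤ n / 2 has an irreducible factor `r` of degree at most n / 2, which
  -- divides X^(p^deg r) − X; the adjoined root of `r` contradicts the hypothesis.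
  refine h (AdjoinRoot r) (AdjoinRoot.root r) (hroot f (hrq.trans hqf)) r.natDegree hrd ?_
  have h3 := hroot _ ((hr.natDegree_dvd_iff_dvd_X_pow_card_pow_sub_X (n := r.natDegree)).mp
    dvd_rfl)
  rw [Nat.card_zmod] at h3
  simpa [sub_eq_zero] using h3

/-- A certificate computed modulo the polynomial and 7: the powers of Frobenius are reduced to
degree at most 11, and each difference α^(7^d) − α is shown to be invertible. -/
theorem pow_seven_pow_ne {E : Type*} [Field E] [CharP E 7] (α : E)
    (hα : α ^ 12 + α ^ 11 + 2 * α ^ 9 + 4 * α ^ 7 + 6 * α ^ 5 + 4 * α ^ 4 + α ^ 3 + α ^ 2 + 3 =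
      0) :
    α ^ 7 ^ 4 ≠ α ∧ α ^ 7 ^ 5 ≠ α ∧ α ^ 7 ^ 6 ≠ α := by
  have hp : (7 : E) = 0 := by exact_mod_cast CharP.cast_eq_zero E 7
  have : Fact (Nat.Prime 7) := ⟨by norm_num⟩
  -- The reductions of α^(7i) for 2 ≤ i ≤ 11. They determine Frobenius on reduced expressions, since
  -- 1 and α^7 are already reduced.
  have r2 : α ^ 14 = -3 * α ^ 11 + 2 * α ^ 10 + α ^ 9 - 3 * α ^ 8 - 3 * α ^ 7 + 2 * α ^ 6 -
    3 * α ^ 5 + 3 * α ^ 4 + 3 * α ^ 2 + 3 * α - 3 := by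
    linear_combination (α ^ 2 - α + 1) * hα + (-α ^ 9 + α ^ 8 - α ^ 7 - α ^ 4 - α ^ 2) * hp
  have r3 : α ^ 21 = 2 * α ^ 11 + 3 * α ^ 10 + 3 * α ^ 9 + 3 * α ^ 8 - 2 * α ^ 7 + 2 * α ^ 6 +
    3 * α ^ 5 - 2 * α ^ 4 + 2 * α ^ 3 - α ^ 2 - 1 := by
    linear_combination α ^ 7 * r2 + (-3 * α ^ 6 - 2 * α ^ 5 + 3 * α ^ 4 + α ^ 2 - 2) * hα +
      (α ^ 17 + α ^ 13 + α ^ 12 + α ^ 11 + 3 * α ^ 10 - α ^ 9 - α ^ 8 + 2 * α ^ 5 + 1) * hp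
  have r4 : α ^ 28 = α ^ 11 - 3 * α ^ 10 - α ^ 9 + α ^ 8 - 3 * α ^ 6 + 2 * α ^ 5 - 3 * α ^ 4 -
    3 * α ^ 3 + 3 * α ^ 2 - α := by
    linear_combination α ^ 7 * r3 + (2 * α ^ 6 + α ^ 5 + 2 * α ^ 4 - 3 * α ^ 3 - α ^ 2 -
      2 * α) * hα + (-α ^ 13 + α ^ 12 - 3 * α ^ 11 + α ^ 10 - 2 * α ^ 9 + 2 * α ^ 8 + 2 * α ^ 7 +
      2 * α ^ 6 + α ^ 5 + 2 * α ^ 3 + α) * hp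
  have r5 : α ^ 35 = 2 * α ^ 11 - α ^ 10 - 3 * α ^ 9 + 2 * α ^ 8 + 2 * α ^ 6 + α ^ 5 + 3 * α ^ 4
    - 3 * α ^ 2 - 2 * α + 1 := by
    linear_combination α ^ 7 * r4 + (α ^ 6 + 3 * α ^ 5 + 3 * α ^ 4 + 3 * α ^ 3 - 2 * α ^ 2 +
      3 * α + 2) * hα + (-α ^ 17 - α ^ 16 - α ^ 15 - α ^ 14 - 2 * α ^ 13 - 3 * α ^ 12 -
      3 * α ^ 11 - 6 * α ^ 10 - 3 * α ^ 9 - 7 * α ^ 8 - 2 * α ^ 7 - 3 * α ^ 6 - 5 * α ^ 5 -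
      3 * α ^ 4 - 2 * α ^ 3 + α ^ 2 - α - 1) * hp
  have r6 : α ^ 42 = -3 * α ^ 10 - 3 * α ^ 9 - 3 * α ^ 8 + α ^ 7 - α ^ 6 - α ^ 5 + α ^ 4 +
    3 * α ^ 3 + α ^ 2 - 2 := by
    linear_combination α ^ 7 * r5 + (2 * α ^ 6 - 3 * α ^ 5 - 2 * α ^ 3 + α ^ 2 + 3) * hα +
      (α ^ 14 - α ^ 13 + 2 * α ^ 12 - 2 * α ^ 11 + 3 * α ^ 10 + 2 * α ^ 8 - α ^ 7 - α ^ 6 - α ^ 5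
      - 2 * α ^ 4 - α ^ 2 - 1) * hp
  have r7 : α ^ 49 = 2 * α ^ 11 - α ^ 10 + α ^ 9 + 2 * α ^ 8 + 2 * α ^ 7 + α ^ 6 - 3 * α ^ 5 +
    α ^ 4 - α ^ 3 - 2 * α ^ 2 - 2 * α := by
    linear_combination α ^ 7 * r6 + (-3 * α ^ 5 - 3 * α ^ 3 + 3 * α ^ 2 + 3 * α) * hα + (α ^ 14 -
      α ^ 13 + 2 * α ^ 12 - α ^ 11 + 4 * α ^ 10 + α ^ 8 - α ^ 7 - 4 * α ^ 6 - α ^ 4 + α ^ 3 -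
      α ^ 2 - α) * hp
  have r8 : α ^ 56 = 3 * α ^ 9 + 2 * α ^ 8 - 2 * α ^ 7 + 2 * α ^ 6 - α ^ 5 - α ^ 4 - 3 * α ^ 3 -
    α ^ 2 + 3 * α - 3 := by
    linear_combination α ^ 7 * r7 + (2 * α ^ 6 - 3 * α ^ 5 - 3 * α ^ 4 + α ^ 3 - α + 1) * hα +
      (α ^ 16 + α ^ 14 + α ^ 12 + α ^ 10 + 3 * α ^ 9 + α ^ 8 + α ^ 5 + α ^ 4) * hp
  have r9 : α ^ 63 = -α ^ 11 - 2 * α ^ 9 + 2 * α ^ 8 + 2 * α ^ 7 - α ^ 6 - 3 * α ^ 5 + 2 * α ^ 3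
    - α ^ 2 + 2 * α + 2 := by
    linear_combination α ^ 7 * r8 + (3 * α ^ 4 - α ^ 3 - α ^ 2 - 3 * α - 3) * hα + (α ^ 12 -
      α ^ 11 + α ^ 10 - α ^ 9 + α ^ 8 + 2 * α ^ 7 + 3 * α ^ 6 + 5 * α ^ 5 + α ^ 4 + α ^ 3 + α ^ 2
      + α + 1) * hp
  have r10 : α ^ 70 = -α ^ 11 + 3 * α ^ 10 - 3 * α ^ 9 - α ^ 8 - 2 * α ^ 7 + α ^ 6 + α ^ 5 +
    α ^ 4 + 2 * α ^ 2 + α - 1 := by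
    linear_combination α ^ 7 * r9 + (-α ^ 6 + α ^ 5 - 3 * α ^ 4 + 2 * α - 2) * hα + (α ^ 15 +
      α ^ 13 - α ^ 12 + 3 * α ^ 11 - α ^ 10 + 3 * α ^ 9 + α ^ 8 + 2 * α ^ 7 - α ^ 6 + 2 * α ^ 4 -
      α + 1) * hp
  have r11 : α ^ 77 = -α ^ 11 - α ^ 9 - 2 * α ^ 8 - α ^ 6 - α ^ 5 + α ^ 4 + 3 * α ^ 2 + α + 1 :=
    by
    linear_combination α ^ 7 * r10 + (-α ^ 6 - 3 * α ^ 5 + α ^ 3 + 3 * α ^ 2 + 2 * α + 2) * hα +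
      (α ^ 17 + α ^ 12 + 2 * α ^ 10 - α ^ 8 - 4 * α ^ 7 - 3 * α ^ 6 - 2 * α ^ 5 - 2 * α ^ 4 -
      α ^ 3 - 2 * α ^ 2 - α - 1) * hp
  have f2 : α ^ 7 ^ 2 = 2 * α ^ 11 - α ^ 10 + α ^ 9 + 2 * α ^ 8 + 2 * α ^ 7 + α ^ 6 - 3 * α ^ 5 +
    α ^ 4 - α ^ 3 - 2 * α ^ 2 - 2 * α := by
    rw [← r7]; norm_num
  have f3 : α ^ 7 ^ 3 = α ^ 11 - α ^ 10 + 2 * α ^ 8 - 3 * α ^ 7 + α ^ 5 - α ^ 3 - 2 * α ^ 2 -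
    3 * α + 1 := by
    have e : α ^ 7 ^ 3 = frobenius E 7 (α ^ 7 ^ 2) := by
      rw [frobenius_def, ← pow_mul]; norm_num
    rw [e, f2]
    simp only [map_add, map_sub, map_mul, map_pow, map_ofNat, frobenius_def]
    linear_combination (-2) * r2 + (-1) * r3 + (1) * r4 + (-3) * r5 + (1) * r6 + (2) * r7 +
      (2) * r8 + (1) * r9 + (-1) * r10 + (2) * r11 + (-2 * α ^ 10 + α ^ 9 + 2 * α ^ 7 - 2 * α ^ 6
      - 2 * α ^ 5 - 2 * α ^ 4 - α ^ 3 + α ^ 2 + α) * hp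
  have f4 : α ^ 7 ^ 4 = -α ^ 10 - 3 * α ^ 9 + 2 * α ^ 8 - 3 * α ^ 7 + 2 * α ^ 6 + 2 * α ^ 5 +
    α ^ 4 + 2 * α ^ 3 - 3 * α ^ 2 - 3 * α - 2 := by
    have e : α ^ 7 ^ 4 = frobenius E 7 (α ^ 7 ^ 3) := by
      rw [frobenius_def, ← pow_mul]; norm_num
    rw [e, f3]
    simp only [map_add, map_sub, map_mul, map_pow, map_ofNat, map_one, frobenius_def]
    linear_combination (-2) * r2 + (-1) * r3 + (1) * r5 + (-3) * r7 + (2) * r8 + (-1) * r10 +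
      (1) * r11 + (-α ^ 10 - α ^ 6 + α ^ 5 - α ^ 4 - α ^ 3 + α + 1) * hp
  have f5 : α ^ 7 ^ 5 = 2 * α ^ 11 + 3 * α ^ 10 + 2 * α ^ 9 - 3 * α ^ 7 - 3 * α ^ 5 - 2 * α ^ 3 -
    2 * α - 1 := by
    have e : α ^ 7 ^ 5 = frobenius E 7 (α ^ 7 ^ 4) := by
      rw [frobenius_def, ← pow_mul]; norm_num
    rw [e, f4]
    simp only [map_add, map_sub, map_neg, map_mul, map_pow, map_ofNat, frobenius_def]
    linear_combination (-3) * r2 + (2) * r3 + (1) * r4 + (2) * r5 + (2) * r6 + (-3) * r7 +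
      (2) * r8 + (-3) * r9 + (-1) * r10 + (2 * α ^ 11 - 2 * α ^ 10 + α ^ 8 - α ^ 7 + 5 * α ^ 5 -
      2 * α ^ 4 - α ^ 2 - α - 1) * hp
  have f6 : α ^ 7 ^ 6 = -2 * α ^ 11 + 2 * α ^ 10 - α ^ 9 + α ^ 7 + 2 * α ^ 5 - 3 * α ^ 4 +
    3 * α ^ 3 - α ^ 2 + 1 := by
    have e : α ^ 7 ^ 6 = frobenius E 7 (α ^ 7 ^ 5) := by
      rw [frobenius_def, ← pow_mul]; norm_num
    rw [e, f5]
    simp only [map_add, map_sub, map_mul, map_pow, map_ofNat, map_one, frobenius_def]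
    linear_combination (-2) * r3 + (-3) * r5 + (-3) * r7 + (2) * r9 + (3) * r10 + (2) * r11 +
      (-3 * α ^ 11 + α ^ 10 - 2 * α ^ 9 - 3 * α ^ 8 - α ^ 7 - 2 * α ^ 6 - α ^ 5 + 4 * α ^ 2 +
      3 * α) * hp
  -- The factor of `h - f4` is the inverse of α^(7^4) − α modulo the polynomial and 7, a Bézout
  -- cofactor; likewise in `g5` and `g6`.
  have g4 : α ^ 7 ^ 4 ≠ α := by
    intro h
    refine one_ne_zero (α := E) ?_
    linear_combination (-3 * α ^ 11 - 2 * α ^ 10 - α ^ 9 - 3 * α ^ 7 - α ^ 6 + α ^ 4 - α ^ 3 +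
      3 * α ^ 2 + 3 * α + 3) * (h - f4) - (3 * α ^ 9 + α ^ 8 + 2 * α ^ 6 - 3 * α ^ 5 + α ^ 4 -
      2 * α ^ 2 + α) * hα - (α ^ 20 - α ^ 16 - 3 * α ^ 15 - 2 * α ^ 14 - 4 * α ^ 13 + 2 * α ^ 12
      - 3 * α ^ 11 + α ^ 10 + α ^ 8 + 4 * α ^ 7 + α ^ 6 + 3 * α ^ 5 - 2 * α ^ 3 - 3 * α ^ 2 -
      3 * α - 1) * hp
  have g5 : α ^ 7 ^ 5 ≠ α := by
    intro h
    refine one_ne_zero (α := E) ?_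
    linear_combination (α ^ 11 - α ^ 10 + 3 * α ^ 7 - 2 * α ^ 6 - 2 * α ^ 5 - 2 * α ^ 4 -
      3 * α ^ 3 - 3 * α ^ 2 + 2 * α - 3) * (h - f5) - (2 * α ^ 10 - α ^ 9 + α ^ 7 - 3 * α ^ 6 +
      3 * α ^ 5 - α ^ 4 - 2 * α ^ 3 - 2 * α ^ 2 + 3) * hα - (-α ^ 19 + α ^ 18 - α ^ 16 -
      2 * α ^ 15 - 5 * α ^ 14 + α ^ 13 - 5 * α ^ 12 + 4 * α ^ 11 + 2 * α ^ 9 + 2 * α ^ 8 +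
      4 * α ^ 7 + 4 * α ^ 6 + 3 * α ^ 3 + α - 1) * hp
  have g6 : α ^ 7 ^ 6 ≠ α := by
    intro h
    refine one_ne_zero (α := E) ?_
    linear_combination (3 * α ^ 11 - 2 * α ^ 10 + α ^ 9 - α ^ 8 - α ^ 7 + 3 * α ^ 6 - α ^ 5 -
      α ^ 4 - 2 * α ^ 3 - α + 2) * (h - f6) - (α ^ 10 + 2 * α ^ 9 + 3 * α ^ 8 + α ^ 7 - 3 * α ^ 6
      - 2 * α ^ 5 + α ^ 4 - 2 * α ^ 3 - 2 * α ^ 2 - α - 2) * hα - (-α ^ 22 + α ^ 21 - 2 * α ^ 20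
      - 2 * α ^ 17 + α ^ 16 - 4 * α ^ 15 + α ^ 14 - 4 * α ^ 13 + 2 * α ^ 11 + 2 * α ^ 10 +
      3 * α ^ 9 + 4 * α ^ 7 + 3 * α ^ 6 + 5 * α ^ 5 + 2 * α ^ 3 + α ^ 2 + 1) * hp
  exact ⟨g4, g5, g6⟩

theorem irreducible_modSeven : Irreducible (X ^ 12 + X ^ 11 + 2 * X ^ 9 + 4 * X ^ 7 + 6 * X ^ 5 +
  4 * X ^ 4 + X ^ 3 + X ^ 2 + 3 : (ZMod 7)[X]) := by
  have : Fact (Nat.Prime 7) := ⟨by norm_num⟩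
  have hdeg : (X ^ 12 + X ^ 11 + 2 * X ^ 9 + 4 * X ^ 7 + 6 * X ^ 5 + 4 * X ^ 4 + X ^ 3 + X ^ 2 +
    3 : (ZMod 7)[X]).natDegree = 12 := by
    compute_degree!
  have hmon : (X ^ 12 + X ^ 11 + 2 * X ^ 9 + 4 * X ^ 7 + 6 * X ^ 5 + 4 * X ^ 4 + X ^ 3 + X ^ 2 +
    3 : (ZMod 7)[X]).Monic := by
    monicity!
  refine irreducible_of_pow_ne _ hmon (fun h => by simp [h] at hdeg) fun E _ _ α hα d hd => ?_
  have hα' : α ^ 12 + α ^ 11 + 2 * α ^ 9 + 4 * α ^ 7 + 6 * α ^ 5 + 4 * α ^ 4 + α ^ 3 + α ^ 2 + 3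
    = 0 := by
    simp only [map_add, map_mul, map_pow, aeval_X, map_ofNat] at hα
    exact hα
  have : CharP E 7 := charP_of_injective_algebraMap (algebraMap (ZMod 7) E).injective 7
  obtain ⟨h4, h5, h6⟩ := pow_seven_pow_ne α hα'
  rw [hdeg] at hd
  -- Exponents 4, 5 and 6 suffice: 1 and 2 divide 4, and 3 divides 6.
  have hpow : ∀ (d : ℕ) (k : ℕ), α ^ 7 ^ d = α → α ^ 7 ^ (d * k) = α := by
    intro d k hd
    induction k with
    | zero => simp
    | succ k ih => rw [Nat.mul_succ, pow_add, pow_mul, ih, hd]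
  have hd' : d = 1 ∨ d = 2 ∨ d = 3 ∨ d = 4 ∨ d = 5 ∨ d = 6 := by
    simp only [Finset.mem_Ioc] at hd
    omega
  intro h
  rcases hd' with rfl | rfl | rfl | rfl | rfl | rfl
  · exact h4 (hpow 1 4 h)
  · exact h4 (hpow 2 2 h)
  · exact h6 (hpow 3 2 h)
  · exact h4 h
  · exact h5 h
  · exact h6 h

/-- At this point the reduction modulo 7 keeps degree 12 and is a unit times the irreducible
polynomial above, so Gauss's lemma lifts irreducibility from 𝔽₇ to ℚ. -/
theorem irreducible_fiberPoly_rat :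
    Irreducible (fiberPoly X (C 1) (C 2) (C 1) (C 3) : ℚ[X]) ∧
      (fiberPoly X (C 1) (C 2) (C 1) (C 3) : ℚ[X]).natDegree = 12 := by
  have h3 : (3 : ZMod 7) ≠ 0 := by decide
  have : Fact (Nat.Prime 7) := ⟨by norm_num⟩
  let F : ℤ[X] := fiberPoly X (C 1) (C 2) (C 1) (C 3)
  have hF7 : F.map (Int.castRingHom (ZMod 7)) = C 3 *
      (X ^ 12 + X ^ 11 + 2 * X ^ 9 + 4 * X ^ 7 + 6 * X ^ 5 + 4 * X ^ 4 + X ^ 3 + X ^ 2 + 3) := by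
    rw [← coe_mapRingHom, map_fiberPoly]
    have h7 : (7 : (ZMod 7)[X]) = 0 := by exact_mod_cast CharP.cast_eq_zero (ZMod 7)[X] 7
    simp only [fiberPoly, polyQ, polyC, polyW, polyT, polyU, coe_mapRingHom, map_X,
      map_ofNat, map_one]
    linear_combination (283 * X ^ 12 + 2235 * X ^ 11 + 87364 * X ^ 10 - 715758 * X ^ 9 +
      1071779 * X ^ 8 + 3806867 * X ^ 7 - 12422329 * X ^ 6 + 3642581 * X ^ 5 + 24951695 * X ^ 4 -
      30941735 * X ^ 3 + 7603778 * X ^ 2 + 2788600 * X + 394013) * h7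

  have hdeg7 : (F.map (Int.castRingHom (ZMod 7))).natDegree = 12 := by
    rw [hF7, natDegree_C_mul h3]
    compute_degree!
  have hirr7 : Irreducible (F.map (Int.castRingHom (ZMod 7))) := by
    rw [hF7]
    exact (irreducible_isUnit_mul (isUnit_C.mpr h3.isUnit)).mpr irreducible_modSeven
  have hFle : F.natDegree ≤ 12 := natDegree_fiberPoly_le _ _ _ _
  have hFdeg : F.natDegree = 12 := le_antisymm hFle (hdeg7 ▸ natDegree_map_le)
  have hmap : F.map (algebraMap ℤ ℚ) = fiberPoly X (C 1) (C 2) (C 1) (C 3) := by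
    rw [← coe_mapRingHom, map_fiberPoly]
    simp only [coe_mapRingHom, map_X, map_ofNat, map_one]
  rw [← hmap]
  refine ⟨irreducible_map_algebraMap_of_irreducible_map (Int.castRingHom (ZMod 7)) F
    (by rw [hdeg7]; exact hFle) hirr7, ?_⟩
  rw [natDegree_map_eq_of_injective (IsFractionRing.injective ℤ ℚ), hFdeg]

end ModSeven

/-! ### Lines through intersections of chords, and symmetries of an array. -/

section Incidence

variable {R : Type*} [CommRing R]

/-- The determinant of the line `⟨q₀, q₁, q₂⟩` and of the chords of the conic through the points
with parameters `a, b` and `c, d`. It vanishes if the three lines are concurrent. -/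
def lineDet (q₀ q₁ q₂ a b c d : R) : R :=
  q₀ * (c + d - (a + b)) + q₁ * (c * d - a * b) + q₂ * ((a + b) * (c * d) - a * b * (c + d))

/-- For distinct points the two differences can be cancelled, so incidence with a cross-hair
intersection becomes the vanishing of the smaller expression `lineDet`. -/
theorem dotProduct_crossHair (q : Fin 3 → R) (x : Letter → R) (M : Matrix (Fin 2) (Fin 3) Letter)
    (i j : Fin 3) :
    q ⬝ᵥ crossHair x M i j = (x (M 1 j) - x (M 0 i)) * (x (M 1 i) - x (M 0 j)) *
      lineDet (q 0) (q 1) (q 2) (x (M 0 i)) (x (M 1 j)) (x (M 0 j)) (x (M 1 i)) := by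
  simp only [crossHair, join, meet, conicPoint, cross_apply, dotProduct, lineDet,
    Fin.sum_univ_three, Matrix.cons_val_zero, Matrix.cons_val_one, Matrix.cons_val]
  ring

theorem crossHair_swap_rows (x : Letter → R) {M M' : Matrix (Fin 2) (Fin 3) Letter}
    (h0 : M' 0 = M 1) (h1 : M' 1 = M 0) (i j : Fin 3) :
    crossHair x M' i j = -crossHair x M i j := by
  have key : ∀ P Q S T : Fin 3 → R, crossProduct (crossProduct T S) (crossProduct Q P) =
      -crossProduct (crossProduct P Q) (crossProduct S T) := fun P Q S T => by
    rw [← cross_anticomm S T, ← cross_anticomm P Q, map_neg, map_neg, LinearMap.neg_apply, neg_neg,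
      cross_anticomm]
  have h0' := congrFun h0
  have h1' := congrFun h1
  rw [crossHair, crossHair, h0', h0', h1', h1']
  exact key _ _ _ _

theorem crossHair_swap (x : Letter → R) (M : Matrix (Fin 2) (Fin 3) Letter) (i j : Fin 3) :
    crossHair x M j i = -crossHair x M i j :=
  (cross_anticomm _ _).symm

theorem pascalLine_swap_rows (x : Letter → R) {M M' : Matrix (Fin 2) (Fin 3) Letter}
    (h0 : M' 0 = M 1) (h1 : M' 1 = M 0) : pascalLine x M' = pascalLine x M := by
  simp [pascalLine, join, crossHair_swap_rows x h0 h1]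

/-- After the shift the line is the join of another pair among the same three collinear points, so
its coordinates agree only up to a factor; hence the cross-multiplied form. -/
theorem pascalLine_shift (x : Letter → R) {M M' : Matrix (Fin 2) (Fin 3) Letter}
    (h : ∀ i j, M' i j = M i (j + 1)) (i j : Fin 3) :
    pascalLine x M' i * pascalLine x M j = pascalLine x M' j * pascalLine x M i := by
  have e1 : crossHair x M' 0 1 = crossHair x M 1 2 := by simp [crossHair, h]
  have e2 : crossHair x M' 1 2 = crossHair x M 2 0 := by simp [crossHair, h]
  obtain ⟨-, -, h3⟩ := pascal_theorem x M
  simp only [pascalLine, e1, e2, crossHair_swap x M 0 2, join] at h3 ⊢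
  generalize crossHair x M 0 1 = P at *
  generalize crossHair x M 1 2 = Q at *
  generalize crossHair x M 0 2 = S at *
  simp only [cross_apply, dotProduct, Fin.sum_univ_three, Matrix.cons_val_zero,
    Matrix.cons_val_one, Matrix.cons_val] at h3
  fin_cases i <;> fin_cases j <;>
  simp only [cross_apply, Matrix.cons_val_zero, Matrix.cons_val_one, Matrix.cons_val, Pi.neg_apply,
    Fin.zero_eta, Fin.mk_one, Fin.reduceFinMk]
  · linear_combination (Q 2) * h3
  · linear_combination (-Q 1) * h3
  · linear_combination (-Q 2) * h3
  · linear_combination (Q 0) * h3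
  · linear_combination (Q 1) * h3
  · linear_combination (-Q 0) * h3

/-- A line through the intersection `[1, u, v]` of two chords. -/
theorem lineDet_eq (q₀ q₁ q₂ a b c d u v : R) (h1 : a * b - (a + b) * u + v = 0)
    (h2 : c * d - (c + d) * u + v = 0) :
    lineDet q₀ q₁ q₂ a b c d = (c + d - (a + b)) * (q₀ + q₁ * u + q₂ * v) := by
  unfold lineDet
  linear_combination (-q₁ - q₂ * (c + d)) * h1 + (q₁ + q₂ * (a + b)) * h2

theorem lineDet_div {K : Type*} [Field K] (q₀ q₁ q₂ a b c d : K) (h0 : q₀ ≠ 0)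
    (h : lineDet q₀ q₁ q₂ a b c d = 0) : lineDet 1 (q₁ / q₀) (q₂ / q₀) a b c d = 0 := by
  unfold lineDet at h ⊢
  field_simp
  linear_combination h

theorem lineDet_of_dotProduct_crossHair {K : Type*} [Field K] (q : Fin 3 → K) (x : Letter → K)
    (hx : Function.Injective x) (M : Matrix (Fin 2) (Fin 3) Letter)
    (hM : Function.Bijective (fun q : Fin 2 × Fin 3 => M q.1 q.2)) (i j : Fin 3) (h0 : q 0 ≠ 0)
    (h : q ⬝ᵥ crossHair x M i j = 0) :
    lineDet 1 (q 1 / q 0) (q 2 / q 0) (x (M 0 i)) (x (M 1 j)) (x (M 0 j)) (x (M 1 i)) = 0 := by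
  have hne : ∀ i j, x (M 1 j) - x (M 0 i) ≠ 0 := fun i j => by
    rw [sub_ne_zero]
    intro h
    have := hM.1 (a₁ := (1, j)) (a₂ := (0, i)) (hx h)
    simp at this
  rw [dotProduct_crossHair] at h
  exact lineDet_div _ _ _ _ _ _ _ h0
    ((mul_eq_zero.mp h).resolve_left (mul_ne_zero (hne _ _) (hne _ _)))

end Incidence

/-! ### Normalized Pascals in the rational function field and the action of permutations. -/

section RatFun

open MvPolynomial

theorem aeval_coord (p : MvPolynomial Letter ℚ) :
    aeval coord p = algebraMap (MvPolynomial Letter ℚ) RatFun p := by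
  have : ((aeval coord : MvPolynomial Letter ℚ →ₐ[ℚ] RatFun) : MvPolynomial Letter ℚ →+* RatFun) =
      algebraMap (MvPolynomial Letter ℚ) RatFun := by
    refine MvPolynomial.ringHom_ext (fun r => ?_) (fun i => ?_)
    · exact congrArg (fun f : ℚ →+* RatFun => f r) (Subsingleton.elim
        (((aeval coord : MvPolynomial Letter ℚ →ₐ[ℚ] RatFun) :
          MvPolynomial Letter ℚ →+* RatFun).comp C)
        ((algebraMap (MvPolynomial Letter ℚ) RatFun).comp C))
    · simp [coord]
  exact congrArg (fun f : MvPolynomial Letter ℚ →+* RatFun => f p) this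

theorem algebraicIndependent_coord : AlgebraicIndependent ℚ coord := by
  rw [algebraicIndependent_iff_injective_aeval]
  intro p q h
  rw [aeval_coord, aeval_coord] at h
  exact IsFractionRing.injective _ _ h

theorem eq_top_of_coord_mem (A : IntermediateField ℚ RatFun) (h : ∀ p, coord p ∈ A) : A = ⊤ := by
  rw [eq_top_iff]
  rintro z -
  obtain ⟨n, d, -, rfl⟩ := IsFractionRing.div_surjective (A := MvPolynomial Letter ℚ) z
  have key : ∀ p : MvPolynomial Letter ℚ, algebraMap _ RatFun p ∈ A := fun p => by
    rw [← aeval_coord]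
    induction p using MvPolynomial.induction_on with
    | C r => rw [aeval_C]; exact A.algebraMap_mem r
    | add p q hp hq => rw [map_add]; exact A.add_mem hp hq
    | mul_X p i hp => rw [map_mul, aeval_X]; exact A.mul_mem hp (h i)
  exact A.div_mem (key n) (key d)

theorem coord_injective : Function.Injective coord :=
  algebraicIndependent_coord.injective

theorem hasVal_pascalLine (pt : Letter → ℚ) (M : Matrix (Fin 2) (Fin 3) Letter) (k : Fin 3) :
    HasVal coord pt (pascalLine coord M k) (pascalLine pt M k) := by
  refine ⟨pascalLine X M k, 1, by simp, ?_, ?_⟩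
  · rw [aeval_coord, aeval_coord, ← pascalLine_map]
    simp only [map_one, mul_one]
    rfl
  · rw [← pascalLine_map]
    simp

/-- The values of the line coordinates of a Pascal at a point. -/
theorem hasVal_pascal (pt : Letter → ℚ) (M : Matrix (Fin 2) (Fin 3) Letter)
    (h : pascalLine pt M 0 ≠ 0) :
    HasVal coord pt (pascal M 1) (pascalLine pt M 1 / pascalLine pt M 0) ∧
      HasVal coord pt (pascal M 2) (pascalLine pt M 2 / pascalLine pt M 0) :=
  ⟨(hasVal_pascalLine pt M 1).div algebraicIndependent_coord (hasVal_pascalLine pt M 0) h,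
    (hasVal_pascalLine pt M 2).div algebraicIndependent_coord (hasVal_pascalLine pt M 0) h⟩

variable {M M' : Matrix (Fin 2) (Fin 3) Letter}

/-- Pascal's theorem in the form used from here on: equations for the normalized coordinates, with
the nonzero vertex differences removed. -/
theorem lineDet_pascal (hM : Function.Bijective (fun q : Fin 2 × Fin 3 => M q.1 q.2))
    {i j : Fin 3} (hij : (i, j) = (0, 1) ∨ (i, j) = (1, 2) ∨ (i, j) = (0, 2)) :
    lineDet 1 (pascal M 1) (pascal M 2) (coord (M 0 i)) (coord (M 1 j)) (coord (M 0 j))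
      (coord (M 1 i)) = 0 := by
  have h : pascalLine coord M ⬝ᵥ crossHair coord M i j = 0 := by
    obtain ⟨h1, h2, h3⟩ := pascal_theorem coord M
    rcases hij with h | h | h <;> obtain ⟨rfl, rfl⟩ := Prod.mk.inj h
    · exact h1
    · exact h2
    · exact h3
  exact lineDet_of_dotProduct_crossHair (pascalLine coord M) coord coord_injective M hM i j
    (pascalLine_coord_ne_zero M hM) h

theorem pascal_swap_rows (h0 : M' 0 = M 1) (h1 : M' 1 = M 0) : pascal M' = pascal M := by
  rw [pascal, pascalLine_swap_rows coord h0 h1, pascal]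

theorem vec_div_eq {K : Type*} [Field K] {p q : Fin 3 → K} (hp : p 0 ≠ 0) (hq : q 0 ≠ 0)
    (h : ∀ i j, p i * q j = p j * q i) :
    ![1, p 1 / p 0, p 2 / p 0] = ![1, q 1 / q 0, q 2 / q 0] := by
  rw [(div_eq_div_iff hp hq).mpr ((h 1 0).trans (mul_comm _ _)),
    (div_eq_div_iff hp hq).mpr ((h 2 0).trans (mul_comm _ _))]

theorem pascal_shift (hM : Function.Bijective (fun q : Fin 2 × Fin 3 => M q.1 q.2))
    (hM' : Function.Bijective (fun q : Fin 2 × Fin 3 => M' q.1 q.2))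
    (h : ∀ i j, M' i j = M i (j + 1)) : pascal M' = pascal M :=
  vec_div_eq (pascalLine_coord_ne_zero M' hM') (pascalLine_coord_ne_zero M hM)
    (pascalLine_shift coord h)

/-- The automorphism of `ℚ(a, …, f)` given by a permutation of the letters. -/
noncomputable def permute (e : Equiv.Perm Letter) : RatFun ≃ₐ[ℚ] RatFun :=
  AlgEquiv.ofRingEquiv (f := IsFractionRing.ringEquivOfRingEquiv (renameEquiv ℚ e).toRingEquiv)
    (fun r => map_ratCast _ r)

theorem permute_coord (e : Equiv.Perm Letter) (p : Letter) :
    permute e (coord p) = coord (e p) := by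
  refine (IsFractionRing.ringEquivOfRingEquiv_algebraMap (K := RatFun) (L := RatFun)
    (renameEquiv ℚ e).toRingEquiv (X p)).trans ?_
  exact congrArg (algebraMap (MvPolynomial Letter ℚ) RatFun) (rename_X e p)

theorem map_pascalLine_div {K L : Type*} [Field K] [Field L] (φ : K →+* L) (x : Letter → K)
    (M : Matrix (Fin 2) (Fin 3) Letter) (k : Fin 3) :
    φ (pascalLine x M k / pascalLine x M 0) =
      pascalLine (fun p => φ (x p)) M k / pascalLine (fun p => φ (x p)) M 0 := by
  rw [map_div₀, pascalLine_map, pascalLine_map]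

theorem permute_pascal (e : Equiv.Perm Letter) (M : Matrix (Fin 2) (Fin 3) Letter) (k : Fin 3) :
    permute e (pascal M k) = pascal (M.map e) k := by
  have h : ∀ k, permute e (pascalLine coord M k / pascalLine coord M 0) =
      pascalLine coord (M.map e) k / pascalLine coord (M.map e) 0 := fun k => by
    refine (map_pascalLine_div (permute e).toRingEquiv.toRingHom coord M k).trans ?_
    have : (fun p => (permute e).toRingEquiv.toRingHom (coord p)) = fun p => coord (e p) :=
      funext (permute_coord e)
    rw [this]
    rfl
  fin_cases k
  · exact map_one (permute e)
  · exact h 1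
  · exact h 2

end RatFun

/-! ### Two inscribed triangles with sides through three common points. -/

section ThreeLines

open IntermediateField

variable {k K : Type*} [Field k] [Field K] [Algebra k K]

/-- The intersection of two chords is rational over the field of definition of two distinct lines
passing through it. -/
theorem chord_point_mem (A : IntermediateField k K) {s t s' t' a b c d : K} (hs : s ∈ A)
    (ht : t ∈ A) (hs' : s' ∈ A) (ht' : t' ∈ A) (hD : a + b - (c + d) ≠ 0)
    (hdet : s * t' - s' * t ≠ 0) (h : lineDet 1 s t a b c d = 0)
    (h' : lineDet 1 s' t' a b c d = 0) :
    (a * b - c * d) / (a + b - (c + d)) ∈ A ∧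
      (a + b) * ((a * b - c * d) / (a + b - (c + d))) - a * b ∈ A := by
  set u := (a * b - c * d) / (a + b - (c + d)) with hu
  have hu' : u * (a + b - (c + d)) = a * b - c * d := div_mul_cancel₀ _ hD
  have hD' : c + d - (a + b) ≠ 0 := by rwa [← neg_sub, neg_ne_zero]
  rw [lineDet_eq _ _ _ _ _ _ _ u ((a + b) * u - a * b) (by ring)
    (by linear_combination hu')] at h h'
  have e := (mul_eq_zero.mp h).resolve_left hD'
  have e' := (mul_eq_zero.mp h').resolve_left hD'
  constructor
  -- Cramer's rule for the intersection of the two lines.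
  · rw [show u = (t - t') / (s * t' - s' * t) by
      rw [eq_div_iff hdet]; linear_combination t' * e - t * e']
    exact A.div_mem (A.sub_mem ht ht') (A.sub_mem (A.mul_mem hs ht') (A.mul_mem hs' ht))
  · rw [show (a + b) * u - a * b = (s' - s) / (s * t' - s' * t) by
      rw [eq_div_iff hdet]; linear_combination s * e' - s' * e]
    exact A.div_mem (A.sub_mem hs' hs) (A.sub_mem (A.mul_mem hs ht') (A.mul_mem hs' ht))

/-- The vertex `a` of an inscribed triangle `abc` of the conic, whose sides `bc`, `ac` and `ab` pass
through three given points, satisfies a quadratic equation. -/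
theorem vertex_quadratic {R : Type*} [CommRing R] {a b c u₁ v₁ u₂ v₂ u₃ v₃ : R}
    (h1 : b * c - (b + c) * u₁ + v₁ = 0) (h2 : a * c - (a + c) * u₂ + v₂ = 0)
    (h3 : a * b - (a + b) * u₃ + v₃ = 0) :
    (u₂ * u₃ - u₁ * (u₃ + u₂) + v₁) * a ^ 2 +
      (u₁ * (v₃ + v₂ + 2 * u₂ * u₃) - (u₃ * v₂ + u₂ * v₃) - v₁ * (u₂ + u₃)) * a +
      (v₂ * v₃ - u₁ * (v₃ * u₂ + v₂ * u₃) + v₁ * u₂ * u₃) = 0 := by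
  -- By `h3` and `h2`, b and c are fractional linear in a, with denominators a − u₃ and a − u₂; this
  -- substitutes them into `h1` and clears denominators.
  linear_combination (a - u₃) * (a - u₂) * h1 - h3 * c * (a - u₂) - (u₃ * a - v₃) * h2 +
    u₁ * (h3 * (a - u₂) + h2 * (a - u₃))

theorem vertex_mem (A : IntermediateField k K) {a b u v : K} (ha : a ∈ A) (hu : u ∈ A) (hv : v ∈ A)
    (h : a * b - (a + b) * u + v = 0) (hau : a ≠ u) : b ∈ A := by
  rw [show b = (u * a - v) / (a - u) by
    rw [eq_div_iff (sub_ne_zero.mpr hau)]; linear_combination h]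
  exact A.div_mem (A.sub_mem (A.mul_mem hu ha) hv) (A.sub_mem ha hu)

/-- If a were u, the first equation would give v = u², so the intersection point would be the conic
point a itself; the second chord would then end at a. -/
theorem vertex_ne {a b c d u v : K} (h : a * b - (a + b) * u + v = 0)
    (h' : c * d - (c + d) * u + v = 0) (hc : a ≠ c) (hd : a ≠ d) : a ≠ u := by
  rintro rfl
  have : (c - a) * (d - a) = 0 := by linear_combination h' - h
  rcases mul_eq_zero.mp this with h | h
  · exact hc (sub_eq_zero.mp h).symm
  · exact hd (sub_eq_zero.mp h).symm

/-- Two triangles `abc` and `efd` inscribed in the conic, whose corresponding sides meet in points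
rational over `A`, are rational over a quadratic extension of `A`. -/
theorem triangles_mem (A : IntermediateField k K) {a b c d e f u₁ v₁ u₂ v₂ u₃ v₃ : K}
    (hu₁ : u₁ ∈ A) (hv₁ : v₁ ∈ A) (hu₂ : u₂ ∈ A) (hv₂ : v₂ ∈ A) (hu₃ : u₃ ∈ A) (hv₃ : v₃ ∈ A)
    (h1 : b * c - (b + c) * u₁ + v₁ = 0) (h2 : a * c - (a + c) * u₂ + v₂ = 0)
    (h3 : a * b - (a + b) * u₃ + v₃ = 0) (h1' : f * d - (f + d) * u₁ + v₁ = 0)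
    (h2' : e * d - (e + d) * u₂ + v₂ = 0) (h3' : e * f - (e + f) * u₃ + v₃ = 0)
    (hae : a ≠ e) (had : a ≠ d) (haf : a ≠ f) (hec : e ≠ c) (heb : e ≠ b)
    (hq : u₂ * u₃ - u₁ * (u₃ + u₂) + v₁ ≠ 0) :
    (∃ p ∈ A, ∃ q ∈ A, a * a + p * a + q = 0) ∧
      ∀ B : IntermediateField k K, A ≤ B → a ∈ B → b ∈ B ∧ c ∈ B ∧ d ∈ B ∧ e ∈ B ∧ f ∈ B := by
  have ea := vertex_quadratic h1 h2 h3
  have ee := vertex_quadratic h1' h2' h3'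
  have hQ2 : u₂ * u₃ - u₁ * (u₃ + u₂) + v₁ ∈ A :=
    A.add_mem (A.sub_mem (A.mul_mem hu₂ hu₃) (A.mul_mem hu₁ (A.add_mem hu₃ hu₂))) hv₁
  have hQ1 : u₁ * (v₃ + v₂ + 2 * u₂ * u₃) - (u₃ * v₂ + u₂ * v₃) - v₁ * (u₂ + u₃) ∈ A :=
    A.sub_mem (A.sub_mem (A.mul_mem hu₁ (A.add_mem (A.add_mem hv₃ hv₂)
      (A.mul_mem (A.mul_mem (ofNat_mem A 2) hu₂) hu₃)))
      (A.add_mem (A.mul_mem hu₃ hv₂) (A.mul_mem hu₂ hv₃))) (A.mul_mem hv₁ (A.add_mem hu₂ hu₃))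
  have hQ0 : v₂ * v₃ - u₁ * (v₃ * u₂ + v₂ * u₃) + v₁ * u₂ * u₃ ∈ A :=
    A.add_mem (A.sub_mem (A.mul_mem hv₂ hv₃) (A.mul_mem hu₁ (A.add_mem (A.mul_mem hv₃ hu₂)
      (A.mul_mem hv₂ hu₃)))) (A.mul_mem (A.mul_mem hv₁ hu₂) hu₃)
  generalize u₂ * u₃ - u₁ * (u₃ + u₂) + v₁ = Q2 at *
  generalize u₁ * (v₃ + v₂ + 2 * u₂ * u₃) - (u₃ * v₂ + u₂ * v₃) - v₁ * (u₂ + u₃) = Q1 at *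
  generalize v₂ * v₃ - u₁ * (v₃ * u₂ + v₂ * u₃) + v₁ * u₂ * u₃ = Q0 at *
  refine ⟨⟨Q1 / Q2, A.div_mem hQ1 hQ2, Q0 / Q2, A.div_mem hQ0 hQ2, ?_⟩, fun B hB ha => ?_⟩
  · field_simp
    linear_combination ea
  -- `a` and `e` are the two distinct roots of one quadratic over `A`, so their sum is in `A`. The
  -- other vertices then follow along the sides.
  · have he : e ∈ B := by
      have : (a - e) * (Q2 * (a + e) + Q1) = 0 := by linear_combination ea - ee
      have := (mul_eq_zero.mp this).resolve_left (sub_ne_zero.mpr hae)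
      rw [show e = -Q1 / Q2 - a by field_simp; linear_combination this]
      exact B.sub_mem (B.div_mem (B.neg_mem (hB hQ1)) (hB hQ2)) ha
    exact ⟨vertex_mem B ha (hB hu₃) (hB hv₃) h3 (vertex_ne h3 h3' hae haf),
      vertex_mem B ha (hB hu₂) (hB hv₂) h2 (vertex_ne h2 h2' hae had),
      vertex_mem B he (hB hu₂) (hB hv₂) h2' (vertex_ne h2' h2 hae.symm hec), he,
      vertex_mem B he (hB hu₃) (hB hv₃) h3' (vertex_ne h3' h3 hae.symm heb)⟩

theorem algEquiv_eq_of_mem_adjoin (φ : K ≃ₐ[k] K) {S : Set K} (h : ∀ z ∈ S, φ z = z) {z : K}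
    (hz : z ∈ adjoin k S) : φ z = z := by
  induction hz using IntermediateField.adjoin_induction with
  | mem z hz => exact h z hz
  | algebraMap r => exact φ.commutes r
  | add x y _ _ hx hy => rw [map_add, hx, hy]
  | inv x _ hx => rw [map_inv₀, hx]
  | mul x y _ _ hx hy => rw [map_mul, hx, hy]

end ThreeLines

section ThreeLinesRatFun

open Letter IntermediateField

theorem coord_mem_fieldOf {X : Set (Fin 3 → RatFun)} {l : Fin 3 → RatFun} (hl : l ∈ X) :
    l 1 ∈ fieldOf X ∧ l 2 ∈ fieldOf X :=
  ⟨subset_adjoin _ _ ⟨l, hl, Or.inl rfl⟩, subset_adjoin _ _ ⟨l, hl, Or.inr rfl⟩⟩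

theorem fieldOf_mono {X Y : Set (Fin 3 → RatFun)} (h : X ⊆ Y) : fieldOf X ≤ fieldOf Y :=
  adjoin.mono _ _ _ fun _ ⟨l, hl, hy⟩ => ⟨l, h hl, hy⟩

theorem coord_ne {p q : Letter} (h : p ≠ q) : coord p ≠ coord q :=
  fun e => h (coord_injective e)

/-- A point at which the coordinates of Pascals are evaluated. -/
def samplePoint : Letter → ℚ
  | A => 1 | B => -3 | C => 2 | D => 7 | E => -6 | F => 5

theorem pascal_det_ne_zero {M M' : Matrix (Fin 2) (Fin 3) Letter}
    (h : pascalLine samplePoint M 0 ≠ 0) (h' : pascalLine samplePoint M' 0 ≠ 0)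
    (hdet : pascalLine samplePoint M 1 * pascalLine samplePoint M' 2 -
      pascalLine samplePoint M' 1 * pascalLine samplePoint M 2 ≠ 0) :
    pascal M 1 * pascal M' 2 - pascal M' 1 * pascal M 2 ≠ 0 := by
  have h1 := hasVal_pascal samplePoint M h
  have h2 := hasVal_pascal samplePoint M' h'
  refine ((h1.1.mul h2.2).sub (h2.1.mul h1.2)).ne_zero algebraicIndependent_coord ?_
  rw [div_mul_div_comm, div_mul_div_comm, mul_comm (pascalLine samplePoint M' 0), ← sub_div]
  exact div_ne_zero hdet (mul_ne_zero h h')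

theorem coord_chord_sub_ne_zero (p q r s : Letter)
    (h : samplePoint p + samplePoint q - (samplePoint r + samplePoint s) ≠ 0) :
    coord p + coord q - (coord r + coord s) ≠ 0 :=
  (((HasVal.var p).add (HasVal.var q)).sub
    ((HasVal.var r).add (HasVal.var s))).ne_zero algebraicIndependent_coord h

/-- The permutation of the letters that interchanges the rows of the arrays of `ℓ₁`, `ℓ₂`, `ℓ₃`. -/
def rowSwap : Equiv.Perm Letter :=
  Equiv.swap A E * Equiv.swap C D * Equiv.swap B F

/-- Interchanging the rows of an array does not change its Pascal, so `rowSwap` fixes every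
generator of this field. -/
theorem permute_rowSwap {z : RatFun} (hz : z ∈ fieldOf {line1, line2, line3}) :
    permute rowSwap z = z := by
  refine algEquiv_eq_of_mem_adjoin _ (fun y hy => ?_) hz
  obtain ⟨l, hl, hy⟩ := hy
  have key : ∀ k, permute rowSwap (l k) = l k := fun k => by
    rcases hl with rfl | rfl | rfl <;>
    exact (permute_pascal _ _ k).trans
      (congrFun (pascal_swap_rows (by decide) (by decide)) k)
  rcases hy with rfl | rfl <;> exact key _

theorem coord_A_not_mem : coord A ∉ fieldOf {line1, line2, line3} := fun h => by
  have := (permute_coord rowSwap A).symm.trans (permute_rowSwap h)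
  exact absurd (coord_injective this) (by decide)

end ThreeLinesRatFun

/-! ### Coordinates of the intersection of two chords. -/

section Chords

open IntermediateField

variable {K : Type*} [Field K]

/-- The abscissa `u` of the intersection `[1, u, v]` of two chords. -/
def chordU (a b c d : K) : K := (a * b - c * d) / (a + b - (c + d))

/-- The ordinate `v` of the intersection `[1, u, v]` of two chords. -/
def chordV (a b c d : K) : K := (a + b) * chordU a b c d - a * b

theorem chord_left (a b c d : K) : a * b - (a + b) * chordU a b c d + chordV a b c d = 0 := by
  unfold chordV; ring

theorem chord_right (a b c d : K) (h : a + b - (c + d) ≠ 0) :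
    c * d - (c + d) * chordU a b c d + chordV a b c d = 0 := by
  unfold chordV chordU; field_simp; ring

theorem chord_eq_comm {a b u v : K} (h : a * b - (a + b) * u + v = 0) :
    b * a - (b + a) * u + v = 0 := by
  linear_combination h

theorem lineDet_reverse {q₀ q₁ q₂ a b c d : K} (h : lineDet q₀ q₁ q₂ a b c d = 0) :
    lineDet q₀ q₁ q₂ d c b a = 0 := by
  unfold lineDet at h ⊢; linear_combination -h

theorem hasVal_chord {k ι : Type*} [Field k] [Algebra k K] {x : ι → K}
    (hx : AlgebraicIndependent k x) {pt : ι → k} (a b c d : ι)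
    (h : pt a + pt b - (pt c + pt d) ≠ 0) :
    HasVal x pt (chordU (x a) (x b) (x c) (x d)) (chordU (pt a) (pt b) (pt c) (pt d)) ∧
      HasVal x pt (chordV (x a) (x b) (x c) (x d)) (chordV (pt a) (pt b) (pt c) (pt d)) := by
  have hab := (HasVal.var (x := x) (pt := pt) a).mul (HasVal.var b)
  have hs := (HasVal.var (x := x) (pt := pt) a).add (HasVal.var b)
  have hu : HasVal x pt (chordU (x a) (x b) (x c) (x d)) (chordU (pt a) (pt b) (pt c) (pt d)) :=
    (hab.sub ((HasVal.var c).mul (HasVal.var d))).div hx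
      (hs.sub ((HasVal.var c).add (HasVal.var d))) h
  exact ⟨hu, (hs.mul hu).sub hab⟩

end Chords

/-! ### The degree for the first three lines, and adequacy of all four. -/

section ThreeLinesRatFun

open Letter IntermediateField

theorem chord_mem {M M' : Matrix (Fin 2) (Fin 3) Letter} {p q r s : Letter}
    (A : IntermediateField ℚ RatFun) (hM : pascal M 1 ∈ A ∧ pascal M 2 ∈ A)
    (hM' : pascal M' 1 ∈ A ∧ pascal M' 2 ∈ A)
    (hD : samplePoint p + samplePoint q - (samplePoint r + samplePoint s) ≠ 0)
    (h : pascalLine samplePoint M 0 ≠ 0) (h' : pascalLine samplePoint M' 0 ≠ 0)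
    (hdet : pascalLine samplePoint M 1 * pascalLine samplePoint M' 2 -
      pascalLine samplePoint M' 1 * pascalLine samplePoint M 2 ≠ 0)
    (hl : lineDet 1 (pascal M 1) (pascal M 2) (coord p) (coord q) (coord r) (coord s) = 0)
    (hl' : lineDet 1 (pascal M' 1) (pascal M' 2) (coord p) (coord q) (coord r) (coord s) = 0) :
    chordU (coord p) (coord q) (coord r) (coord s) ∈ A ∧
      chordV (coord p) (coord q) (coord r) (coord s) ∈ A :=
  chord_point_mem A hM.1 hM.2 hM'.1 hM'.2 (coord_chord_sub_ne_zero p q r s hD)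
    (pascal_det_ne_zero h h' hdet) hl hl'

theorem chord_quadratic_ne_zero : chordU (coord A) (coord C) (coord D) (coord E) *
      chordU (coord A) (coord B) (coord F) (coord E) - chordU (coord D) (coord F) (coord B) (coord C)
      * (chordU (coord A) (coord B) (coord F) (coord E) +
        chordU (coord A) (coord C) (coord D) (coord E)) +
      chordV (coord D) (coord F) (coord B) (coord C) ≠ 0 := by
  have h1 := hasVal_chord algebraicIndependent_coord (pt := samplePoint) D F B C
    (by norm_num [samplePoint])
  have h2 := hasVal_chord algebraicIndependent_coord (pt := samplePoint) A C D E
    (by norm_num [samplePoint])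
  have h3 := hasVal_chord algebraicIndependent_coord (pt := samplePoint) A B F E
    (by norm_num [samplePoint])
  refine (((h2.1.mul h3.1).sub (h1.1.mul (h3.1.add h2.1))).add h1.2).ne_zero
    algebraicIndependent_coord ?_
  norm_num [samplePoint, chordU, chordV]

/-- The pairwise intersections of the three lines are BC∩DF, AC∩DE and AB∩EF, so `triangles_mem`
applies to the triangles ABC and EFD. -/
theorem coord_A_quadratic :
    (∃ p ∈ fieldOf {line1, line2, line3},
      ∃ q ∈ fieldOf {line1, line2, line3}, coord A * coord A + p * coord A + q = 0) ∧
      ∀ B : IntermediateField ℚ RatFun, fieldOf {line1, line2, line3} ≤ B → coord A ∈ B → B = ⊤ := by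
  have m1 := coord_mem_fieldOf (X := {line1, line2, line3}) (l := line1) (by simp)
  have m2 := coord_mem_fieldOf (X := {line1, line2, line3}) (l := line2) (by simp)
  have m3 := coord_mem_fieldOf (X := {line1, line2, line3}) (l := line3) (by simp)
  have p1 := chord_mem (M := !![A, D, B; E, C, F]) (M' := !![A, C, F; E, D, B])
    (p := D) (q := F) (r := B) (s := C) _ m1 m2 (by decide +kernel)
    (by decide +kernel) (by decide +kernel) (by decide +kernel)
    (lineDet_pascal (M := !![A, D, B; E, C, F]) (by decide) (i := 1) (j := 2) (Or.inr (Or.inl rfl)))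
    (lineDet_reverse (lineDet_pascal (M := !![A, C, F; E, D, B]) (by decide) (i := 1) (j := 2) (Or.inr (Or.inl rfl))))
  have p2 := chord_mem (M := !![A, D, B; E, C, F]) (M' := !![A, D, F; E, C, B])
    (p := A) (q := C) (r := D) (s := E) _ m1 m3 (by decide +kernel)
    (by decide +kernel) (by decide +kernel) (by decide +kernel)
    (lineDet_pascal (M := !![A, D, B; E, C, F]) (by decide) (i := 0) (j := 1) (Or.inl rfl))
    (lineDet_pascal (M := !![A, D, F; E, C, B]) (by decide) (i := 0) (j := 1) (Or.inl rfl))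
  have p3 := chord_mem (M := !![A, C, F; E, D, B]) (M' := !![A, D, F; E, C, B])
    (p := A) (q := B) (r := F) (s := E) _ m2 m3 (by decide +kernel)
    (by decide +kernel) (by decide +kernel) (by decide +kernel)
    (lineDet_pascal (M := !![A, C, F; E, D, B]) (by decide) (i := 0) (j := 2) (Or.inr (Or.inr rfl)))
    (lineDet_pascal (M := !![A, D, F; E, C, B]) (by decide) (i := 0) (j := 2) (Or.inr (Or.inr rfl)))
  have hD : ∀ p q r s, _ := coord_chord_sub_ne_zero
  obtain ⟨h1, h2⟩ := triangles_mem (fieldOf {line1, line2, line3}) p1.1 p1.2 p2.1 p2.2 p3.1 p3.2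
    (chord_right _ _ _ _ (hD D F B C (by norm_num [samplePoint])))
    (chord_left _ _ _ _) (chord_left _ _ _ _) (chord_eq_comm (chord_left _ _ _ _))
    (chord_eq_comm (chord_right _ _ _ _ (hD A C D E (by norm_num [samplePoint]))))
    (chord_eq_comm (chord_right _ _ _ _ (hD A B F E (by norm_num [samplePoint]))))
    (coord_ne (by decide)) (coord_ne (by decide)) (coord_ne (by decide)) (coord_ne (by decide))
    (coord_ne (by decide)) chord_quadratic_ne_zero
  refine ⟨h1, fun B hB hA => eq_top_of_coord_mem B ?_⟩
  obtain ⟨hb, hc, hd, he, hf⟩ := h2 B hB hA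
  rintro (_ | _ | _ | _ | _ | _) <;> assumption

theorem finrank_three_lines : Module.finrank (fieldOf {line1, line2, line3}) RatFun = 2 := by
  obtain ⟨⟨p, hp, q, hq, h⟩, htop⟩ := coord_A_quadratic
  have := relfinrank_sup_adjoin_of_quadratic _ _ p q hp hq h coord_A_not_mem
  rwa [htop _ le_sup_left (le_sup_right (a := fieldOf {line1, line2, line3})
    (subset_adjoin ℚ {coord A} rfl)), relfinrank_top_right] at this

/-- `rowSwap` fixes the field of the three lines but not this coordinate, as its values at the
sample point show. -/
theorem lineStar_not_mem : lineStar 1 ∉ fieldOf {line1, line2, line3} := fun h => by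
  have e := (permute_pascal rowSwap !![A, B, C; F, D, E] 1).symm.trans (permute_rowSwap h)
  have h1 := hasVal_pascal samplePoint !![A, B, C; F, D, E]
    (by decide +kernel)
  have h2 := hasVal_pascal samplePoint (!![A, B, C; F, D, E].map rowSwap)
    (by decide +kernel)
  refine (h2.1.sub h1.1).ne_zero algebraicIndependent_coord ?_ (sub_eq_zero.mpr e)
  decide +kernel

/-- An extension of prime degree 2 has no proper intermediate field, and `ℓ⋆` contributes a
coordinate outside the smaller field. -/
theorem isAdequate_four_lines : IsAdequate {line1, line2, line3, lineStar} := by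
  have hle : fieldOf {line1, line2, line3} ≤ fieldOf {line1, line2, line3, lineStar} :=
    fieldOf_mono fun l hl => by
      rcases hl with rfl | rfl | rfl
      · exact Or.inl rfl
      · exact Or.inr (Or.inl rfl)
      · exact Or.inr (Or.inr (Or.inl rfl))
  have h := relfinrank_mul_finrank_top hle
  rw [finrank_three_lines] at h
  rcases (Nat.dvd_prime Nat.prime_two).mp ⟨_, h.symm⟩ with h1 | h1
  · exact absurd (relfinrank_eq_one_iff.mp h1
      (coord_mem_fieldOf (Or.inr (Or.inr (Or.inr rfl)))).1) lineStar_not_mem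
  · rw [h1, ← relfinrank_top_right] at h
    exact top_le_iff.mp (relfinrank_eq_one_iff.mp (by omega))

end ThreeLinesRatFun

/-! ### Polynomial identities for the elimination of b + d. -/

section Elimination

variable {R : Type*} [CommRing R]

theorem map_polyQ {S : Type*} [CommRing S] (φ : R →+* S) (y m₁ m₂ h : R) :
    φ (polyQ y m₁ m₂ h) = polyQ (φ y) (φ m₁) (φ m₂) (φ h) := by
  simp only [polyQ, map_add, map_sub, map_mul, map_pow, map_neg, map_ofNat]

theorem map_polyC {S : Type*} [CommRing S] (φ : R →+* S) (y m₁ m₂ h : R) :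
    φ (polyC y m₁ m₂ h) = polyC (φ y) (φ m₁) (φ m₂) (φ h) := by
  simp only [polyC, map_add, map_sub, map_mul, map_pow, map_neg, map_ofNat]

theorem map_polyW {S : Type*} [CommRing S] (φ : R →+* S) (y m₁ m₂ h : R) :
    φ (polyW y m₁ m₂ h) = polyW (φ y) (φ m₁) (φ m₂) (φ h) := by
  simp only [polyW, map_add, map_sub, map_mul, map_pow, map_neg, map_ofNat]

theorem map_polyU {S : Type*} [CommRing S] (φ : R →+* S) (y m₁ m₂ h : R) :
    φ (polyU y m₁ m₂ h) = polyU (φ y) (φ m₁) (φ m₂) (φ h) := by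
  simp only [polyU, map_add, map_sub, map_mul, map_pow, map_neg, map_ofNat]

/-- This and the next three identities split powers of 1 + y, 1 − y and, in `polyQ_identity`, m₂ −
m₁y² off expressions arising in the resultant. What is left are the building blocks of `fiberPoly`.
-/
theorem polyC_identity (y m₁ m₂ h : R) :
    (h * ((m₁ * y - m₂) * (1 + y)) - (1 - y ^ 2)) ^ 2 *
        ((m₁ * y - m₂) * (1 + y) * (1 - y) ^ 2 + (m₁ * y + m₂) * (1 - y) * (1 + y) ^ 2) -
      ((1 - y ^ 2) - h * ((m₁ * y + m₂) * (1 - y))) * (2 * (1 + y) * polyW y m₁ m₂ h) *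
        (1 + y) ^ 2 = 4 * (1 + y) ^ 3 * (1 - y) * polyC y m₁ m₂ h := by
  unfold polyC polyW
  ring

theorem polyU_identity (y m₁ m₂ h : R) :
    2 * (1 + y) * polyW y m₁ m₂ h *
        (((1 - y ^ 2) - h * ((m₁ * y + m₂) * (1 - y))) ^ 2 * (1 + y) ^ 2 +
          (h * ((m₁ * y - m₂) * (1 + y)) - (1 - y ^ 2)) ^ 2 * (1 - y) ^ 2) -
      2 * ((1 - y ^ 2) - h * ((m₁ * y + m₂) * (1 - y))) *
        (h * ((m₁ * y - m₂) * (1 + y)) - (1 - y ^ 2)) ^ 2 *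
        ((m₁ * y - m₂) * (1 + y) * (1 - y) ^ 2 + (m₁ * y + m₂) * (1 - y) * (1 + y) ^ 2) =
      -8 * (1 + y) ^ 3 * (1 - y) ^ 2 * polyU y m₁ m₂ h := by
  unfold polyU polyW
  ring

theorem polyT_identity (y m₁ m₂ h : R) :
    2 * ((1 - y ^ 2) - h * ((m₁ * y + m₂) * (1 - y))) * (2 * (1 + y) * polyW y m₁ m₂ h) -
      4 * ((m₁ * y + m₂) * (1 - y)) * (h * ((m₁ * y - m₂) * (1 + y)) - (1 - y ^ 2)) ^ 2 =
      4 * (1 - y ^ 2) * polyT y m₁ m₂ h := by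
  unfold polyT polyW
  ring

theorem polyQ_identity (y m₁ m₂ h : R) :
    (((1 - y ^ 2) - h * ((m₁ * y + m₂) * (1 - y))) ^ 2 * (1 + y) ^ 2 -
        (h * ((m₁ * y - m₂) * (1 + y)) - (1 - y ^ 2)) ^ 2 * (1 - y) ^ 2) * polyW y m₁ m₂ h ^ 2 +
      4 * (m₁ * y + m₂) * (h * ((m₁ * y - m₂) * (1 + y)) - (1 - y ^ 2)) ^ 2 * (1 + y) *
        (1 - y) ^ 2 * polyC y m₁ m₂ h =
      4 * (m₂ - m₁ * y ^ 2) * (1 + y) ^ 2 * (1 - y) ^ 2 * polyQ y m₁ m₂ h := by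
  unfold polyQ polyC polyW
  ring

/-- With p = bd(1 − y²) and q = ae(1 − y²), the left side is what the incidences yield for ad + be
after multiplication by its denominator. -/
theorem polyW_identity (y m₁ m₂ h : R) :
    (3 * ((m₁ * y - m₂) * (1 + y)) - (m₁ * y + m₂) * (1 - y)) * (1 - y ^ 2) -
      3 * h * ((m₁ * y - m₂) * (1 + y)) * ((m₁ * y + m₂) * (1 - y)) +
      h * ((m₁ * y - m₂) * (1 + y)) ^ 2 = 2 * (1 + y) * polyW y m₁ m₂ h := by
  unfold polyW
  ring

/-- The quadratic equations `α₂ S² + α₁ S + α₀ = 0` and `γ₂ S² + γ₁ S + γ₀ = 0` have a vanishing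
resultant. -/
theorem resultant_eq_zero {α₂ α₁ α₀ γ₂ γ₁ γ₀ S : R} (hα : α₂ * S ^ 2 + α₁ * S + α₀ = 0)
    (hγ : γ₂ * S ^ 2 + γ₁ * S + γ₀ = 0) :
    (α₂ * γ₁ - α₁ * γ₂) * S + (α₂ * γ₀ - α₀ * γ₂) = 0 ∧
      (α₂ * γ₀ - α₀ * γ₂) * S ^ 2 + (α₁ * γ₀ - α₀ * γ₁) * S = 0 :=
  ⟨by linear_combination α₂ * hγ - γ₂ * hα, by linear_combination γ₀ * hα - α₀ * hγ⟩

/-- The left sides are the 2 × 2 minors of the coefficients of the two quadratics in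
`hexagon_quadratics`. They share a factor that is nonzero for generic hexagons, and dividing it out
brings the resultant down to degree 12. -/
theorem resultant_coefficients (y m₁ m₂ g h A B w p q k : R)
    (hA : A = h * ((m₁ * y - m₂) * (1 + y)) - (1 - y ^ 2))
    (hB : B = (1 - y ^ 2) - h * ((m₁ * y + m₂) * (1 - y)))
    (hw : w = 2 * (1 + y) * polyW y m₁ m₂ h) (hp : p = (m₁ * y - m₂) * (1 + y))
    (hq : q = (m₁ * y + m₂) * (1 - y)) (hk : k = 2 * (m₂ - m₁ * y ^ 2)) :
    (1 - y ^ 2) * (B ^ 2 * (1 + y) ^ 2 - A ^ 2 * (1 - y) ^ 2) *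
          -((1 - y ^ 2) * k * g * w * (1 + y) ^ 2) -
        2 * (1 - y ^ 2) * B * k * g * (1 + y) ^ 2 *
          ((1 - y ^ 2) * (A ^ 2 * (p * (1 - y) ^ 2 + q * (1 + y) ^ 2) - B * w * (1 + y) ^ 2)) =
      -(8 * k * (1 + y) ^ 7 * (1 - y) ^ 2 * (g * (1 - y) ^ 2 * polyU y m₁ m₂ h)) ∧
    (1 - y ^ 2) * (B ^ 2 * (1 + y) ^ 2 - A ^ 2 * (1 - y) ^ 2) * (w ^ 2 * (1 + y) ^ 2) -
        ((1 - y ^ 2) * k ^ 2 * g ^ 2 * (1 + y) ^ 2 - 4 * q * A ^ 2 * (1 + y) ^ 2) *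
          ((1 - y ^ 2) * (A ^ 2 * (p * (1 - y) ^ 2 + q * (1 + y) ^ 2) - B * w * (1 + y) ^ 2)) =
      8 * k * (1 + y) ^ 7 * (1 - y) ^ 2 * ((1 - y) *
        (polyQ y m₁ m₂ h - (m₂ - m₁ * y ^ 2) * g ^ 2 * polyC y m₁ m₂ h)) ∧
    2 * (1 - y ^ 2) * B * k * g * (1 + y) ^ 2 * (w ^ 2 * (1 + y) ^ 2) -
        ((1 - y ^ 2) * k ^ 2 * g ^ 2 * (1 + y) ^ 2 - 4 * q * A ^ 2 * (1 + y) ^ 2) *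
          -((1 - y ^ 2) * k * g * w * (1 + y) ^ 2) =
      8 * k * (1 + y) ^ 7 * (1 - y) ^ 2 * (g * polyW y m₁ m₂ h *
        (polyT y m₁ m₂ h + (m₂ - m₁ * y ^ 2) ^ 2 * g ^ 2)) := by
  have iC := polyC_identity y m₁ m₂ h
  have iU := polyU_identity y m₁ m₂ h
  have iT := polyT_identity y m₁ m₂ h
  have iQ := polyQ_identity y m₁ m₂ h
  rw [← hA, ← hB, ← hw, ← hp, ← hq] at iC iU
  rw [← hA, ← hB, ← hw, ← hq] at iT
  rw [← hA, ← hB] at iQ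
  generalize p * (1 - y) ^ 2 + q * (1 + y) ^ 2 = Z at *
  generalize polyC y m₁ m₂ h = pC at *
  generalize polyW y m₁ m₂ h = pW at *
  generalize polyU y m₁ m₂ h = pU at *
  generalize polyT y m₁ m₂ h = pT at *
  generalize polyQ y m₁ m₂ h = pQ at *
  generalize m₂ - m₁ * y ^ 2 = l at *
  generalize m₁ * y + m₂ = n at *
  clear hA hB hp
  subst hk hq
  refine ⟨?_, ?_, ?_⟩
  · linear_combination (1 - y ^ 2) ^ 2 * (2 * l) * g * (1 + y) ^ 2 * iU
  · rw [iC]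
    subst hw
    linear_combination 4 * (1 + y) ^ 5 * (1 - y) * iQ
  · linear_combination (1 - y ^ 2) * (2 * l) * g * (1 + y) ^ 4 * w * iT +
      8 * (1 - y ^ 2) ^ 2 * l * g * (1 + y) ^ 4 * (pT + l ^ 2 * g ^ 2) * hw

end Elimination

/-! ### The fiber: hexagons of the form (a, b, −b, d, e, −d) with three given Pascals. -/

section Hexagon

variable {K : Type*} [Field K] {a b d e m₁ m₂ g h y : K}

/-- The relations between the parameters of a hexagon and those of three of its Pascals, for
`y = (b + d + e - a) / (a + b + d - e)`. -/
theorem hexagon_relations (hy : y * (a + b + d - e) = b + d + e - a)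
    (h1 : m₁ * (b + d + e - a) = a * b * d + a * b * e - b * d * e + a * d * e)
    (h2 : m₂ * (a + b + d - e) = -(a * b * d) + a * d * e + a * b * e + b * d * e)
    (hI : lineDet 1 g h a e (-b) (-d) = 0) (hII : lineDet 1 g h a d b (-d) = 0)
    (hIII : lineDet 1 g h b e (-b) d = 0) (hT : a + b + d - e ≠ 0) (hG : g - h * (b + d) ≠ 0) :
    b * d * (1 - y) = m₁ * y - m₂ ∧ a * e * (1 + y) = m₁ * y + m₂ ∧
      (1 + y) * (a - e) = (1 - y) * (b + d) ∧
      (h * ((m₁ * y - m₂) * (1 + y)) - (1 - y ^ 2)) * (a + e) =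
        2 * (m₂ - m₁ * y ^ 2) * g + ((1 - y ^ 2) - h * ((m₁ * y + m₂) * (1 - y))) * (b + d) ∧
      (h * ((m₁ * y - m₂) * (1 + y)) - (1 - y ^ 2)) * (a * d + b * e) * (1 - y ^ 2) =
        2 * (1 + y) * polyW y m₁ m₂ h := by
  have eP : b * d * (1 - y) = m₁ * y - m₂ := mul_right_cancel₀ hT (by
    linear_combination (-(b * d) - m₁) * hy - h1 + h2)
  have eQ : a * e * (1 + y) = m₁ * y + m₂ := mul_right_cancel₀ hT (by
    linear_combination (a * e - m₁) * hy - h1 - h2)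
  have e4 : (h * (b * d) - 1) * (a + e) = (a * e - b * d) * g + (1 - h * (a * e)) * (b + d) := by
    unfold lineDet at hI
    linear_combination hI
  -- Modulo `e4`, this combination of the three incidences of `ℓ⋆` is divisible by g − h(b + d);
  -- cancelling that factor leaves an equation linear in ad + be.
  have e5 : (h * (b * d) - 1) * (a * d + b * e) =
      (h * (b * d) - 1) * (a * e - 3 * (b * d)) - 4 * h * (b * d) * (a * e - b * d) := by
    apply mul_right_cancel₀ hG
    unfold lineDet at hI hII hIII
    linear_combination (h * (b * d) - 1) * (hI - hII - hIII) - 4 * h * (b * d) * e4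
  refine ⟨eP, eQ, mul_right_cancel₀ hT (by linear_combination (a - e + (b + d)) * hy), ?_, ?_⟩
  · rw [← eP, ← eQ]
    linear_combination (1 - y ^ 2) * e4 + g * (1 - y) * eQ - g * (1 + y) * eP
  · rw [← polyW_identity, ← eP, ← eQ]
    linear_combination (1 - y ^ 2) ^ 2 * e5

/-- Once a ± e, bd, ae and ad + be are expressed through y and S = b + d, two constraints on S
remain: (a + e)² = (a − e)² + 4ae, and the quadratic relation W² − (a + e)(b + d)W + bd(a − e)² +
ae(b + d)² = 0 for W = ad + be. -/
theorem hexagon_quadratics {A B k w p q : K} (hA : A * (a + e) = k * g + B * (b + d))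
    (hw : A * (a * d + b * e) * (1 - y ^ 2) = w) (hy : (1 + y) * (a - e) = (1 - y) * (b + d))
    (hp : b * d * (1 - y ^ 2) = p) (hq : a * e * (1 - y ^ 2) = q) :
    (1 - y ^ 2) * (B ^ 2 * (1 + y) ^ 2 - A ^ 2 * (1 - y) ^ 2) * (b + d) ^ 2 +
        2 * (1 - y ^ 2) * B * k * g * (1 + y) ^ 2 * (b + d) +
        ((1 - y ^ 2) * k ^ 2 * g ^ 2 * (1 + y) ^ 2 - 4 * q * A ^ 2 * (1 + y) ^ 2) = 0 ∧
      (1 - y ^ 2) * (A ^ 2 * (p * (1 - y) ^ 2 + q * (1 + y) ^ 2) - B * w * (1 + y) ^ 2) *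
          (b + d) ^ 2 + -((1 - y ^ 2) * k * g * w * (1 + y) ^ 2) * (b + d) +
          w ^ 2 * (1 + y) ^ 2 = 0 := by
  subst hw hp hq
  constructor
  · linear_combination -(1 - y ^ 2) * (1 + y) ^ 2 * (A * (a + e) + k * g + B * (b + d)) * hA +
      A ^ 2 * (1 - y ^ 2) * ((1 + y) * (a - e) + (1 - y) * (b + d)) * hy
  · linear_combination (1 - y ^ 2) * (1 + y) ^ 2 * (A * (a * d + b * e) * (1 - y ^ 2)) * (b + d) *
      hA - (1 - y ^ 2) ^ 2 * A ^ 2 * (b * d) * ((1 + y) * (a - e) + (1 - y) * (b + d)) * hy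

/-- A linear equation for `b + d`, and the equation of `y`. -/
theorem hexagon_resultant (hy : y * (a + b + d - e) = b + d + e - a)
    (h1 : m₁ * (b + d + e - a) = a * b * d + a * b * e - b * d * e + a * d * e)
    (h2 : m₂ * (a + b + d - e) = -(a * b * d) + a * d * e + a * b * e + b * d * e)
    (hI : lineDet 1 g h a e (-b) (-d) = 0) (hII : lineDet 1 g h a d b (-d) = 0)
    (hIII : lineDet 1 g h b e (-b) d = 0) (hT : a + b + d - e ≠ 0) (hG : g - h * (b + d) ≠ 0)
    (hk : 8 * (2 * (m₂ - m₁ * y ^ 2)) * (1 + y) ^ 7 * (1 - y) ^ 2 ≠ 0) :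
    g * (1 - y) ^ 2 * polyU y m₁ m₂ h * (b + d) =
      (1 - y) * (polyQ y m₁ m₂ h - (m₂ - m₁ * y ^ 2) * g ^ 2 * polyC y m₁ m₂ h) ∧
    (1 - y) * (polyQ y m₁ m₂ h - (m₂ - m₁ * y ^ 2) * g ^ 2 * polyC y m₁ m₂ h) * (b + d) ^ 2 +
      g * polyW y m₁ m₂ h * (polyT y m₁ m₂ h + (m₂ - m₁ * y ^ 2) ^ 2 * g ^ 2) * (b + d) = 0 := by
  obtain ⟨eP, eQ, er, eA, ew⟩ := hexagon_relations hy h1 h2 hI hII hIII hT hG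
  obtain ⟨E1, E2⟩ := hexagon_quadratics (p := (m₁ * y - m₂) * (1 + y))
    (q := (m₁ * y + m₂) * (1 - y)) eA ew er (by linear_combination (1 + y) * eP)
    (by linear_combination (1 - y) * eQ)
  obtain ⟨R1, R2⟩ := resultant_eq_zero E1 E2
  obtain ⟨c1, c2, c3⟩ := resultant_coefficients y m₁ m₂ g h _ _ _ _ _ _ rfl rfl rfl rfl rfl rfl
  rw [c1, c2] at R1
  rw [c2, c3] at R2
  exact ⟨mul_left_cancel₀ hk (by linear_combination -R1),
    mul_left_cancel₀ hk (by linear_combination R2)⟩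

theorem poly_mem {k : Type*} [Field k] [Algebra k K] (G : IntermediateField k K) (hy : y ∈ G)
    (h1 : m₁ ∈ G) (h2 : m₂ ∈ G) (hh : h ∈ G) :
    polyQ y m₁ m₂ h ∈ G ∧ polyC y m₁ m₂ h ∈ G ∧ polyW y m₁ m₂ h ∈ G ∧ polyU y m₁ m₂ h ∈ G := by
  lift y to G using hy
  lift m₁ to G using h1
  lift m₂ to G using h2
  lift h to G using hh
  refine ⟨?_, ?_, ?_, ?_⟩
  · exact (map_polyQ (algebraMap G K) y m₁ m₂ h).subst (motive := (· ∈ G)) (polyQ y m₁ m₂ h).2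
  · exact (map_polyC (algebraMap G K) y m₁ m₂ h).subst (motive := (· ∈ G)) (polyC y m₁ m₂ h).2
  · exact (map_polyW (algebraMap G K) y m₁ m₂ h).subst (motive := (· ∈ G)) (polyW y m₁ m₂ h).2
  · exact (map_polyU (algebraMap G K) y m₁ m₂ h).subst (motive := (· ∈ G)) (polyU y m₁ m₂ h).2

/-- The parameter `y` of a hexagon is a root of `fiberPoly`, and determines the hexagon. -/
theorem hexagon_fiber [CharZero K] {k : Type*} [Field k] [Algebra k K]
    (hy : y * (a + b + d - e) = b + d + e - a)
    (h1 : m₁ * (b + d + e - a) = a * b * d + a * b * e - b * d * e + a * d * e)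
    (h2 : m₂ * (a + b + d - e) = -(a * b * d) + a * d * e + a * b * e + b * d * e)
    (hI : lineDet 1 g h a e (-b) (-d) = 0) (hII : lineDet 1 g h a d b (-d) = 0)
    (hIII : lineDet 1 g h b e (-b) d = 0) (hT : a + b + d - e ≠ 0) (hG : g - h * (b + d) ≠ 0)
    (hS : b + d ≠ 0) (hae : a - e ≠ 0) (hκ : a * e - b * d ≠ 0) (hA : h * (b * d) - 1 ≠ 0)
    (hg : g ≠ 0) (hU : polyU y m₁ m₂ h ≠ 0) :
    fiberPoly y m₁ m₂ g h = 0 ∧ ∀ G : IntermediateField k K, m₁ ∈ G → m₂ ∈ G → g ∈ G → h ∈ G →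
      y ∈ G → a ∈ G ∧ b ∈ G ∧ d ∈ G ∧ e ∈ G := by
  have h2' : (2 : K) ≠ 0 := two_ne_zero
  have hy1 : 1 + y ≠ 0 := left_ne_zero_of_mul (b := a + b + d - e)
    (by rw [show (1 + y) * (a + b + d - e) = 2 * (b + d) by linear_combination hy]
        exact mul_ne_zero h2' hS)
  have hy2 : 1 - y ≠ 0 := left_ne_zero_of_mul (b := a + b + d - e)
    (by rw [show (1 - y) * (a + b + d - e) = 2 * (a - e) by linear_combination -hy]
        exact mul_ne_zero h2' hae)
  have hyy : 1 - y ^ 2 ≠ 0 := by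
    rw [show 1 - y ^ 2 = (1 + y) * (1 - y) by ring]
    exact mul_ne_zero hy1 hy2
  obtain ⟨eP, eQ, er, eA, ew⟩ := hexagon_relations hy h1 h2 hI hII hIII hT hG
  have hk : 2 * (m₂ - m₁ * y ^ 2) ≠ 0 := by
    rw [show 2 * (m₂ - m₁ * y ^ 2) = (a * e - b * d) * (1 - y ^ 2) by
      linear_combination (1 + y) * eP - (1 - y) * eQ]
    exact mul_ne_zero hκ hyy
  have hA' : h * ((m₁ * y - m₂) * (1 + y)) - (1 - y ^ 2) ≠ 0 := by
    rw [show h * ((m₁ * y - m₂) * (1 + y)) - (1 - y ^ 2) = (h * (b * d) - 1) * (1 - y ^ 2) by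
      linear_combination -h * (1 + y) * eP]
    exact mul_ne_zero hA hyy
  obtain ⟨R1, R2⟩ := hexagon_resultant hy h1 h2 hI hII hIII hT hG
    (mul_ne_zero (mul_ne_zero (mul_ne_zero (by norm_num) hk) (pow_ne_zero _ hy1))
      (pow_ne_zero _ hy2))
  constructor
  -- One factor b + d is cancelled from the second resultant relation; eliminating b + d between the
  -- two linear relations gives `fiberPoly`.
  · have h3 := mul_right_cancel₀ hS (by
      linear_combination R2 : ((1 - y) * (polyQ y m₁ m₂ h -
        (m₂ - m₁ * y ^ 2) * g ^ 2 * polyC y m₁ m₂ h) * (b + d) + g * polyW y m₁ m₂ h *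
        (polyT y m₁ m₂ h + (m₂ - m₁ * y ^ 2) ^ 2 * g ^ 2)) * (b + d) = 0 * (b + d))
    refine mul_left_cancel₀ (pow_ne_zero 2 hy2) ?_
    unfold fiberPoly
    generalize polyQ y m₁ m₂ h - (m₂ - m₁ * y ^ 2) * g ^ 2 * polyC y m₁ m₂ h = V at *
    generalize polyT y m₁ m₂ h + (m₂ - m₁ * y ^ 2) ^ 2 * g ^ 2 = T at *
    linear_combination -(1 - y) * V * R1 + g * (1 - y) ^ 2 * polyU y m₁ m₂ h * h3
  · intro G m1 m2 mg mh my
    obtain ⟨mQ, mC, mW, mU⟩ := poly_mem G my m1 m2 mh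
    have one := G.one_mem
    have mk := G.sub_mem m2 (G.mul_mem m1 (pow_mem my 2))
    -- The hexagon is recovered from y: first b + d from the linear relation, then a + e, a − e and
    -- ad + be, and finally b from b(a − e) = a(b + d) − (ad + be).
    have mS : b + d ∈ G := by
      rw [eq_div_of_mul_eq (mul_ne_zero (mul_ne_zero hg (pow_ne_zero 2 hy2)) hU)
        ((mul_comm _ _).trans R1)]
      exact G.div_mem (G.mul_mem (G.sub_mem one my)
        (G.sub_mem mQ (G.mul_mem (G.mul_mem mk (pow_mem mg 2)) mC)))
        (G.mul_mem (G.mul_mem mg (pow_mem (G.sub_mem one my) 2)) mU)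
    have mD := G.sub_mem one (pow_mem my 2)
    have mA := G.sub_mem (G.mul_mem mh (G.mul_mem (G.sub_mem (G.mul_mem m1 my) m2)
      (G.add_mem one my))) mD
    have mσ : a + e ∈ G := by
      rw [eq_div_of_mul_eq hA' ((mul_comm _ _).trans eA)]
      exact G.div_mem (G.add_mem (G.mul_mem (G.mul_mem (ofNat_mem G 2) mk) mg)
        (G.mul_mem (G.sub_mem mD (G.mul_mem mh (G.mul_mem (G.add_mem (G.mul_mem m1 my) m2)
          (G.sub_mem one my)))) mS)) mA
    have mδ : a - e ∈ G := by
      rw [eq_div_of_mul_eq hy1 ((mul_comm _ _).trans er)]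
      exact G.div_mem (G.mul_mem (G.sub_mem one my) mS) (G.add_mem one my)
    have mw : a * d + b * e ∈ G := by
      rw [show a * d + b * e = 2 * (1 + y) * polyW y m₁ m₂ h / _ from
        eq_div_of_mul_eq (mul_ne_zero hA' hyy) (by linear_combination ew)]
      exact G.div_mem (G.mul_mem (G.mul_mem (ofNat_mem G 2) (G.add_mem one my)) mW)
        (G.mul_mem mA mD)
    have ma : a ∈ G := by
      rw [show a = ((a + e) + (a - e)) / 2 by ring]
      exact G.div_mem (G.add_mem mσ mδ) (ofNat_mem G 2)
    have me : e ∈ G := by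
      rw [show e = (a + e) - a by ring]
      exact G.sub_mem mσ ma
    have mb : b ∈ G := by
      rw [show b = (a * (b + d) - (a * d + b * e)) / (a - e) by field_simp; ring]
      exact G.div_mem (G.sub_mem (G.mul_mem ma mS) mw) mδ
    refine ⟨ma, mb, ?_, me⟩
    rw [show d = (b + d) - b by ring]
    exact G.sub_mem mS mb

end Hexagon

/-! ### Values of the large polynomials at a point. -/

section Specialization

open MvPolynomial

variable {ι k L : Type*} [Field k] [Field L] [Algebra k L] {x : ι → L} {pt : ι → k}

theorem HasVal.aeval {κ : Type*} {z : κ → L} {q : κ → k} (h : ∀ i, HasVal x pt (z i) (q i))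
    (p : MvPolynomial κ k) : HasVal x pt (aeval z p) (eval q p) := by
  induction p using MvPolynomial.induction_on with
  | C r => simpa using HasVal.const r
  | add p p' hp hp' => simpa using hp.add hp'
  | mul_X p i hp => simpa using hp.mul (h i)

theorem HasVal.polyU {y m₁ m₂ h : L} {y' m₁' m₂' h' : k} (hy : HasVal x pt y y')
    (h1 : HasVal x pt m₁ m₁') (h2 : HasVal x pt m₂ m₂') (hh : HasVal x pt h h') :
    HasVal x pt (polyU y m₁ m₂ h) (polyU y' m₁' m₂' h') := by
  have := HasVal.aeval (z := ![y, m₁, m₂, h]) (q := ![y', m₁', m₂', h'])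
    (by rw [Fin.forall_fin_succ, Fin.forall_fin_succ, Fin.forall_fin_succ, Fin.forall_fin_one]
        exact ⟨hy, h1, h2, hh⟩) (PascalHexagram.polyU (X 0) (X 1) (X 2) (X 3))
  rw [← AlgHom.coe_toRingHom, map_polyU, map_polyU] at this
  simpa using this

theorem HasVal.fiberPoly {y m₁ m₂ g h : L} {y' m₁' m₂' g' h' : k} (hy : HasVal x pt y y')
    (h1 : HasVal x pt m₁ m₁') (h2 : HasVal x pt m₂ m₂') (hg : HasVal x pt g g')
    (hh : HasVal x pt h h') :
    HasVal x pt (fiberPoly y m₁ m₂ g h) (fiberPoly y' m₁' m₂' g' h') := by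
  have := HasVal.aeval (z := ![y, m₁, m₂, g, h]) (q := ![y', m₁', m₂', g', h'])
    (by rw [Fin.forall_fin_succ, Fin.forall_fin_succ, Fin.forall_fin_succ, Fin.forall_fin_succ,
          Fin.forall_fin_one]
        exact ⟨hy, h1, h2, hg, hh⟩) (PascalHexagram.fiberPoly (X 0) (X 1) (X 2) (X 3) (X 4))
  rw [← AlgHom.coe_toRingHom, map_fiberPoly, map_fiberPoly] at this
  simpa using this

end Specialization

/-! ### Degree 12 for the generic hexagon. -/

section Degree

open MvPolynomial IntermediateField

/-- The degree of a root of a polynomial with generic coefficients, some specialization of which is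
irreducible. -/
theorem relfinrank_of_specialization {ι k L : Type*} [Field k] [Field L] [Algebra k L] {x : ι → L}
    (hx : AlgebraicIndependent k x) (f : Polynomial (MvPolynomial ι k)) (pt : ι → k)
    (hdeg : f.natDegree ≤ (f.map (eval pt)).natDegree) (hirr : Irreducible (f.map (eval pt)))
    (y : L) (hy : f.eval₂ ((aeval x : MvPolynomial ι k →ₐ[k] L) : MvPolynomial ι k →+* L) y = 0) :
    (adjoin k (Set.range x)).relfinrank (adjoin k (Set.range x) ⊔ adjoin k {y}) =
      f.natDegree := by
  let A := adjoin k (Set.range x)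
  let w : ι → A := fun i => ⟨x i, subset_adjoin _ _ (Set.mem_range_self i)⟩
  let ψ : MvPolynomial ι k →+* A := (aeval w : MvPolynomial ι k →ₐ[k] A)
  have hψ : ∀ p, (ψ p : L) = aeval x p := fun p => comp_aeval_apply w A.val p
  have hψinj : Function.Injective ψ := fun p q hpq => hx (by rw [← hψ, ← hψ, hpq])
  rw [relfinrank_sup_adjoin_of_irreducible A (f.map ψ)
    (irreducible_of_specialization hx A rfl f ψ hψ pt hdeg hirr) y,
    Polynomial.natDegree_map_eq_of_injective hψinj]
  rw [Polynomial.aeval_def, Polynomial.eval₂_map, ← hy]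
  congr 1
  exact RingHom.ext hψ

theorem isAlgebraic_of_sup_adjoin_eq_top {k L : Type*} [Field k] [Field L] [Algebra k L]
    (A : IntermediateField k L) {S : Set L} (hS : ∀ y ∈ S, IsAlgebraic A y)
    (h : A ⊔ adjoin k S = ⊤) : Algebra.IsAlgebraic A L := by
  have hle : A ⊔ adjoin k S ≤ (algebraicClosure A L).restrictScalars k := by
    refine sup_le (fun z hz => ?_) (adjoin_le_iff.mpr fun y hy => ?_)
    · exact mem_algebraicClosure_iff.mpr (isAlgebraic_algebraMap (⟨z, hz⟩ : A))
    · exact mem_algebraicClosure_iff.mpr (hS y hy)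
  rw [h] at hle
  exact ⟨fun z => mem_algebraicClosure_iff.mp (hle mem_top)⟩

/-- A nonzero value at 0 is enough to know that the polynomial is not zero. Irreducibility cannot be
used here, because it rests on the independence that this lemma helps to prove. -/
theorem isAlgebraic_of_fiberPoly {k L : Type*} [Field k] [Field L] [Algebra k L]
    (A : IntermediateField k L) {y m₁ m₂ g h : L} (h1 : m₁ ∈ A) (h2 : m₂ ∈ A) (hg : g ∈ A)
    (hh : h ∈ A) (h0 : fiberPoly 0 m₁ m₂ g h ≠ 0) (hy : fiberPoly y m₁ m₂ g h = 0) :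
    IsAlgebraic A y := by
  lift m₁ to A using h1
  lift m₂ to A using h2
  lift g to A using hg
  lift h to A using hh
  have key : ∀ z : L, Polynomial.eval₂RingHom (algebraMap A L) z
      (fiberPoly Polynomial.X (.C m₁) (.C m₂) (.C g) (.C h)) = fiberPoly z m₁ m₂ g h := fun z => by
    rw [map_fiberPoly]
    simp
  refine ⟨fiberPoly Polynomial.X (.C m₁) (.C m₂) (.C g) (.C h), fun h => h0 ?_, ?_⟩
  · rw [← key 0, h, map_zero]
  · exact (key y).trans hy

variable {L : Type*} [Field L] [Algebra ℚ L]

/-- The degree of `fiberPoly` over the field generated by its coefficients. -/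
theorem relfinrank_fiberPoly {u r m₁ m₂ g h y : L}
    (hx : AlgebraicIndependent ℚ ![u, r, m₁, m₂, g, h]) (hy : fiberPoly y m₁ m₂ g h = 0) :
    (adjoin ℚ (Set.range ![u, r, m₁, m₂, g, h])).relfinrank
      (adjoin ℚ (Set.range ![u, r, m₁, m₂, g, h]) ⊔ adjoin ℚ {y}) = 12 := by
  let f : Polynomial (MvPolynomial (Fin 6) ℚ) :=
    fiberPoly Polynomial.X (.C (X 2)) (.C (X 3)) (.C (X 4)) (.C (X 5))
  -- The coefficients do not involve u and r, whose values are arbitrary; the other four are those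
  -- of `irreducible_fiberPoly_rat`.
  have hf : f.map (eval ![0, 0, 1, 2, 1, 3]) =
      fiberPoly Polynomial.X (.C 1) (.C 2) (.C 1) (.C 3) := by
    rw [← Polynomial.coe_mapRingHom, map_fiberPoly]
    simp
  obtain ⟨hirr, hdeg⟩ := irreducible_fiberPoly_rat
  rw [← hf] at hirr hdeg
  have hle : f.natDegree ≤ 12 := natDegree_fiberPoly_le _ _ _ _
  have hf12 : f.natDegree = 12 := le_antisymm hle (hdeg ▸ Polynomial.natDegree_map_le)
  refine (relfinrank_of_specialization hx f _ (hle.trans hdeg.ge) hirr y ?_).trans hf12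
  rw [← Polynomial.coe_eval₂RingHom, map_fiberPoly]
  simpa using hy

theorem algebraicIndependent_of_adjoin_eq_top {n : ℕ} {x : Fin n → L} (htr : Algebra.trdeg ℚ L = n)
    (htop : adjoin ℚ (Set.range x) = ⊤) : AlgebraicIndependent ℚ x := by
  have htop_alg : Algebra.IsAlgebraic (⊤ : IntermediateField ℚ L) L :=
    Algebra.IsAlgebraic.mk fun z => isAlgebraic_algebraMap (Subtype.mk z mem_top)
  rw [← htop] at htop_alg
  exact algebraicIndependent_of_isAlgebraic_adjoin _ (by rw [htr, Fintype.card_fin])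

/-- The field of definition of three Pascals of a generic hexagon, in suitable coordinates. -/
theorem relfinrank_hexagon {u r a b d e m₁ m₂ g h : L} (htr : Algebra.trdeg ℚ L = 6)
    (htop : adjoin ℚ (Set.range ![u, r, a, b, d, e]) = ⊤)
    (h1 : m₁ * (b + d + e - a) = a * b * d + a * b * e - b * d * e + a * d * e)
    (h2 : m₂ * (a + b + d - e) = -(a * b * d) + a * d * e + a * b * e + b * d * e)
    (hI : lineDet 1 g h a e (-b) (-d) = 0) (hII : lineDet 1 g h a d b (-d) = 0)
    (hIII : lineDet 1 g h b e (-b) d = 0) :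
    (adjoin ℚ (Set.range ![u, r, m₁, m₂, g, h])).relfinrank ⊤ = 12 := by
  have : CharZero L := algebraRat.charZero L
  have htr' : Algebra.trdeg ℚ L = Fintype.card (Fin 6) := by rw [htr, Fintype.card_fin]; rfl
  have hz := algebraicIndependent_of_adjoin_eq_top (n := 6) htr htop
  let pt : Fin 6 → ℚ := ![0, 1, 3, 1, 2, -1]
  have va : HasVal ![u, r, a, b, d, e] pt a 3 := HasVal.var (2 : Fin 6)
  have vb : HasVal ![u, r, a, b, d, e] pt b 1 := HasVal.var (3 : Fin 6)
  have vd : HasVal ![u, r, a, b, d, e] pt d 2 := HasVal.var (4 : Fin 6)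
  have ve : HasVal ![u, r, a, b, d, e] pt e (-1) := HasVal.var (5 : Fin 6)
  have vT := ((va.add vb).add vd).sub ve
  have vT' := ((vb.add vd).add ve).sub va
  have v1 := HasVal.of_mul_eq hz vT' (by norm_num) (((((va.mul vb).mul vd).add
    ((va.mul vb).mul ve)).sub ((vb.mul vd).mul ve)).add ((va.mul vd).mul ve)) h1
  have v2 := HasVal.of_mul_eq hz vT (by norm_num) (((((va.mul vb).mul vd).neg.add
    ((va.mul vd).mul ve)).add ((va.mul vb).mul ve)).add ((vb.mul vd).mul ve)) h2
  have vc1 := (vb.add vd).add (va.add ve)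
  have vl1 := (vb.mul vd).sub (va.mul ve)
  have vn1 := ((va.add ve).mul (vb.mul vd)).add ((va.mul ve).mul (vb.add vd))
  have vc2 := (vd.add vd).add (va.sub vb)
  have vl2 := ((vb.mul vd).add (va.mul vd)).neg
  have vn2 := (((va.add vd).mul (vb.mul vd)).add ((va.mul vd).mul (vb.sub vd))).neg
  have vdet := (vl1.mul vn2).sub (vl2.mul vn1)
  -- Cramer's rule: `hI` and `hII` are linear in g and h with determinant `vdet`.
  have vg := HasVal.of_mul_eq (z := g) hz vdet (by norm_num) ((vc1.mul vn2).sub (vc2.mul vn1)) (by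
    unfold lineDet at hI hII
    linear_combination (-((a + d) * (b * d) + a * d * (b - d))) * hI -
      ((a + e) * (b * d) + a * e * (b + d)) * hII)
  have vh := HasVal.of_mul_eq (z := h) hz vdet (by norm_num) ((vl1.mul vc2).sub (vl2.mul vc1)) (by
    unfold lineDet at hI hII
    linear_combination (b * d + a * d) * hI + (b * d - a * e) * hII)
  have vy := vT'.div hz vT (by norm_num)
  have hT := vT.ne_zero hz (by norm_num)
  obtain ⟨hroot, hmem⟩ := hexagon_fiber (k := ℚ) (div_mul_cancel₀ _ hT) h1 h2 hI hII hIII hT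
    ((vg.sub (vh.mul (vb.add vd))).ne_zero hz (by norm_num))
    ((vb.add vd).ne_zero hz (by norm_num)) ((va.sub ve).ne_zero hz (by norm_num))
    (((va.mul ve).sub (vb.mul vd)).ne_zero hz (by norm_num))
    (((vh.mul (vb.mul vd)).sub HasVal.one).ne_zero hz (by norm_num))
    (vg.ne_zero hz (by norm_num)) ((vy.polyU v1 v2 vh).ne_zero hz (by norm_num [polyU]))
  set y := (b + d + e - a) / (a + b + d - e)
  have hFtop : adjoin ℚ (Set.range ![u, r, m₁, m₂, g, h]) ⊔ adjoin ℚ {y} = ⊤ := by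
    have hl : ∀ i, ![u, r, m₁, m₂, g, h] i ∈
        adjoin ℚ (Set.range ![u, r, m₁, m₂, g, h]) ⊔ adjoin ℚ {y} := fun i =>
      (le_sup_left : _ ≤ adjoin ℚ (Set.range ![u, r, m₁, m₂, g, h]) ⊔ adjoin ℚ {y})
        (subset_adjoin _ _ (Set.mem_range_self i))
    have hy : y ∈ adjoin ℚ (Set.range ![u, r, m₁, m₂, g, h]) ⊔ adjoin ℚ {y} :=
      (le_sup_right : _ ≤ adjoin ℚ (Set.range ![u, r, m₁, m₂, g, h]) ⊔ adjoin ℚ {y})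
        (subset_adjoin _ _ rfl)
    obtain ⟨ha, hb, hd, he⟩ := hmem _ (hl 2) (hl 3) (hl 4) (hl 5) hy
    rw [← top_le_iff, ← htop, adjoin_le_iff]
    rintro _ ⟨i, rfl⟩
    revert i
    simp only [Fin.forall_fin_succ]
    exact ⟨hl 0, hl 1, ha, hb, hd, he, fun i => i.elim0⟩
  -- `L` has transcendence degree 6 and is algebraic over the field of these six elements.
  have hx : AlgebraicIndependent ℚ ![u, r, m₁, m₂, g, h] := by
    have : Algebra.IsAlgebraic (adjoin ℚ (Set.range ![u, r, m₁, m₂, g, h])) L := by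
      refine isAlgebraic_of_sup_adjoin_eq_top _ (fun z hzy => ?_) hFtop
      rw [Set.mem_singleton_iff.mp hzy]
      have hl : ∀ i, ![u, r, m₁, m₂, g, h] i ∈ adjoin ℚ (Set.range ![u, r, m₁, m₂, g, h]) :=
        fun i => subset_adjoin _ _ (Set.mem_range_self i)
      have v0 : HasVal ![u, r, a, b, d, e] pt 0 0 := by
        simpa using HasVal.const (x := ![u, r, a, b, d, e]) (pt := pt) 0
      exact isAlgebraic_of_fiberPoly _ (hl 2) (hl 3) (hl 4) (hl 5)
        ((v0.fiberPoly v1 v2 vg vh).ne_zero hz (by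
          norm_num [fiberPoly, polyQ, polyC, polyW, polyT, polyU])) hroot
    exact algebraicIndependent_of_isAlgebraic_adjoin _ htr'
  rw [← hFtop]
  exact relfinrank_fiberPoly hx hroot

end Degree

/-! ### Moving the fixed points of an involution to 0 and ∞. -/

section Moebius

open IntermediateField

variable {K : Type*} [Field K]

/-- The parameter of the conic for which the points with parameters `u + r` and `u - r` become
`0` and `∞`. -/
def moebius (u r x : K) : K := (x - u - r) / (x - u + r)

/-- First coordinate of the line `⟨1, s, t⟩` after the change of parameter `moebius`. -/
def moebiusAlpha (u r s t : K) : K := 1 + s * (u + r) + t * (u + r) ^ 2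

/-- Second coordinate of the line `⟨1, s, t⟩` after the change of parameter `moebius`. -/
def moebiusBeta (u r s t : K) : K := -2 - 2 * s * u - 2 * t * (u ^ 2 - r ^ 2)

/-- Third coordinate of the line `⟨1, s, t⟩` after the change of parameter `moebius`. -/
def moebiusGamma (u r s t : K) : K := 1 + s * (u - r) + t * (u - r) ^ 2

/-- A change of parameter extends to a projective map of the plane preserving the conic, hence
concurrency. The factor 8r³ is the cube of the determinant 2r of `moebius`. -/
theorem lineDet_moebius {u r s t a b c d : K} (ha : a - u + r ≠ 0) (hb : b - u + r ≠ 0)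
    (hc : c - u + r ≠ 0) (hd : d - u + r ≠ 0) (h : lineDet 1 s t a b c d = 0) :
    lineDet (moebiusAlpha u r s t) (moebiusBeta u r s t) (moebiusGamma u r s t) (moebius u r a)
      (moebius u r b) (moebius u r c) (moebius u r d) = 0 := by
  unfold lineDet moebius moebiusAlpha moebiusBeta moebiusGamma
  unfold lineDet at h
  field_simp
  linear_combination 8 * r ^ 3 * h

/-- The hypothesis pairs x with y under the involution with fixed points u ± r; with these at 0 and
∞ it becomes negation. -/
theorem moebius_neg {u r x y : K} (h : (x - u) * (y - u) = r ^ 2)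
    (hx : x - u + r ≠ 0) (hy : y - u + r ≠ 0) : moebius u r y = -moebius u r x := by
  unfold moebius
  rw [← neg_div, div_eq_div_iff hy hx]
  linear_combination 2 * h

theorem eq_moebius_inv [CharZero K] {u r x : K} (hr : r ≠ 0) (hx : x - u + r ≠ 0) :
    x = u + r * (1 + moebius u r x) / (1 - moebius u r x) := by
  have h1 : 1 - moebius u r x = 2 * r / (x - u + r) := by
    unfold moebius
    field_simp
    ring
  have h2 : 1 + moebius u r x = 2 * (x - u) / (x - u + r) := by
    unfold moebius
    field_simp
    ring
  rw [h1, h2]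
  field_simp
  ring

theorem line_mem_of_moebius [CharZero K] {k : Type*} [Field k] [Algebra k K]
    (A : IntermediateField k K) {u r s t ν : K} (hr : r ≠ 0) (hν : ν ≠ 0) (mu : u ∈ A) (mr : r ∈ A)
    (mα : moebiusAlpha u r s t / ν ∈ A) (mβ : moebiusBeta u r s t / ν ∈ A)
    (mγ : moebiusGamma u r s t / ν ∈ A) : s ∈ A ∧ t ∈ A := by
  have hr4 : 4 * r ^ 2 ≠ 0 := mul_ne_zero (by norm_num) (pow_ne_zero 2 hr)
  have mr4 : 4 * r ^ 2 ∈ A := A.mul_mem (ofNat_mem A 4) (pow_mem mr 2)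
  -- Only ratios of the new coordinates are given. The scale ν is recovered because the first of the
  -- old coordinates is 1.
  have e0 : 4 * r ^ 2 / ν = moebiusAlpha u r s t / ν * (u - r) ^ 2 +
      moebiusBeta u r s t / ν * (u ^ 2 - r ^ 2) + moebiusGamma u r s t / ν * (u + r) ^ 2 := by
    unfold moebiusAlpha moebiusBeta moebiusGamma
    field_simp
    ring
  have mν : ν ∈ A := by
    rw [show ν = 4 * r ^ 2 / (4 * r ^ 2 / ν) by field_simp, e0]
    exact A.div_mem mr4 (A.add_mem (A.add_mem (A.mul_mem mα (pow_mem (A.sub_mem mu mr) 2))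
      (A.mul_mem mβ (A.sub_mem (pow_mem mu 2) (pow_mem mr 2))))
      (A.mul_mem mγ (pow_mem (A.add_mem mu mr) 2)))
  have lift : ∀ {z : K}, z / ν ∈ A → z ∈ A := fun {z} hz => by
    rw [← div_mul_cancel₀ z hν]
    exact A.mul_mem hz mν
  have mα' := lift mα
  have mγ' := lift mγ
  have ms := A.add_mem (A.add_mem mα' (lift mβ)) mγ'
  constructor
  · rw [show s = (-2 * u * (moebiusAlpha u r s t + moebiusBeta u r s t + moebiusGamma u r s t) +
        2 * r * (moebiusAlpha u r s t - moebiusGamma u r s t)) / (4 * r ^ 2) by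
      rw [eq_div_iff hr4]
      unfold moebiusAlpha moebiusBeta moebiusGamma
      ring]
    exact A.div_mem (A.add_mem (A.mul_mem (A.mul_mem (A.neg_mem (ofNat_mem A 2)) mu) ms)
      (A.mul_mem (A.mul_mem (ofNat_mem A 2) mr) (A.sub_mem mα' mγ'))) mr4
  · rw [show t = (moebiusAlpha u r s t + moebiusBeta u r s t + moebiusGamma u r s t) /
        (4 * r ^ 2) by
      rw [eq_div_iff hr4]
      unfold moebiusAlpha moebiusBeta moebiusGamma
      ring]
    exact A.div_mem ms mr4

theorem moebius_mem_of_line {k : Type*} [Field k] [Algebra k K]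
    (A : IntermediateField k K) {u r s t : K} (mu : u ∈ A) (mr : r ∈ A) (ms : s ∈ A) (mt : t ∈ A) :
    moebiusAlpha u r s t ∈ A ∧ moebiusBeta u r s t ∈ A ∧ moebiusGamma u r s t ∈ A :=
  ⟨A.add_mem (A.add_mem A.one_mem (A.mul_mem ms (A.add_mem mu mr)))
      (A.mul_mem mt (pow_mem (A.add_mem mu mr) 2)),
    A.sub_mem (A.sub_mem (A.neg_mem (ofNat_mem A 2)) (A.mul_mem (A.mul_mem (ofNat_mem A 2) ms) mu))
      (A.mul_mem (A.mul_mem (ofNat_mem A 2) mt) (A.sub_mem (pow_mem mu 2) (pow_mem mr 2))),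
    A.add_mem (A.add_mem A.one_mem (A.mul_mem ms (A.sub_mem mu mr)))
      (A.mul_mem mt (pow_mem (A.sub_mem mu mr) 2))⟩

theorem moebius_ne_zero [CharZero K] {u r s t : K} (hr : r ≠ 0) (h1 : moebiusAlpha u r s t = 0)
    (h2 : moebiusBeta u r s t = 0) (h3 : moebiusGamma u r s t = 0) : False := by
  have : 4 * r ^ 2 = 0 := by
    have : 4 * r ^ 2 = moebiusAlpha u r s t * (u - r) ^ 2 +
        moebiusBeta u r s t * (u ^ 2 - r ^ 2) + moebiusGamma u r s t * (u + r) ^ 2 := by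
      unfold moebiusAlpha moebiusBeta moebiusGamma
      ring
    rw [this, h1, h2, h3]
    ring
  exact mul_ne_zero (by norm_num) (pow_ne_zero 2 hr) this

end Moebius

/-! ### Two Pascals through a common point and a third one, in the new parameter. -/

section ThreePascals

open IntermediateField Letter

variable {L : Type*} [Field L] [Algebra ℚ L]

/-- Inequalities that hold for generic hexagons. -/
theorem generic_hexagon_ne_zero {u r a b d e : L} (htr : Algebra.trdeg ℚ L = 6)
    (htop : adjoin ℚ (Set.range ![u, r, a, b, d, e]) = ⊤) :
    a + b + d - e ≠ 0 ∧ b + d + e - a ≠ 0 ∧ b ^ 2 - d ^ 2 ≠ 0 ∧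
      (b * d - a * e) * ((a + d) * (b * d) + a * d * (b - d)) -
        (b * d + a * d) * ((a + e) * (b * d) + a * e * (b + d)) ≠ 0 := by
  have hz := algebraicIndependent_of_adjoin_eq_top (n := 6) htr htop
  let pt : Fin 6 → ℚ := ![0, 1, 3, 1, 2, -1]
  have va : HasVal ![u, r, a, b, d, e] pt a 3 := HasVal.var (2 : Fin 6)
  have vb : HasVal ![u, r, a, b, d, e] pt b 1 := HasVal.var (3 : Fin 6)
  have vd : HasVal ![u, r, a, b, d, e] pt d 2 := HasVal.var (4 : Fin 6)
  have ve : HasVal ![u, r, a, b, d, e] pt e (-1) := HasVal.var (5 : Fin 6)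
  exact ⟨(((va.add vb).add vd).sub ve).ne_zero hz (by norm_num),
    (((vb.add vd).add ve).sub va).ne_zero hz (by norm_num),
    ((vb.pow 2).sub (vd.pow 2)).ne_zero hz (by norm_num),
    ((((vb.mul vd).sub (va.mul ve)).mul (((va.add vd).mul (vb.mul vd)).add
      ((va.mul vd).mul (vb.sub vd)))).sub (((vb.mul vd).add (va.mul vd)).mul
      (((va.add ve).mul (vb.mul vd)).add ((va.mul ve).mul (vb.add vd))))).ne_zero hz (by norm_num)⟩

/-- Carries the problem to `relfinrank_hexagon`: over `M` with r adjoined, the old line coordinates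
and u, r, m₁, m₂, g, h determine each other rationally. -/
theorem relfinrank_three_pascals (htr : Algebra.trdeg ℚ L = 6) {x : Letter → L} {u r : L}
    (hr : r ≠ 0) (hden : ∀ p, x p - u + r ≠ 0) (hbc : (x B - u) * (x C - u) = r ^ 2)
    (hdf : (x D - u) * (x F - u) = r ^ 2)
    (hgen : ∀ A : IntermediateField ℚ L, r ∈ A → (∀ p, x p ∈ A) → A = ⊤)
    {s₁ t₁ s₂ t₂ s₃ t₃ : L} (M : IntermediateField ℚ L) (hu : u ∈ M)
    (hM : s₁ ∈ M ∧ t₁ ∈ M ∧ s₂ ∈ M ∧ t₂ ∈ M ∧ s₃ ∈ M ∧ t₃ ∈ M)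
    (hMle : ∀ A : IntermediateField ℚ L, s₁ ∈ A → t₁ ∈ A → s₂ ∈ A → t₂ ∈ A → s₃ ∈ A → t₃ ∈ A →
      M ≤ A)
    (i1 : lineDet 1 s₁ t₁ (x D) (x F) (x B) (x C) = 0)
    (i1' : lineDet 1 s₁ t₁ (x A) (x F) (x B) (x E) = 0)
    (i2 : lineDet 1 s₂ t₂ (x C) (x B) (x F) (x D) = 0)
    (i2' : lineDet 1 s₂ t₂ (x A) (x B) (x F) (x E) = 0)
    (j1 : lineDet 1 s₃ t₃ (x A) (x D) (x B) (x F) = 0)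
    (j2 : lineDet 1 s₃ t₃ (x B) (x E) (x C) (x D) = 0)
    (j3 : lineDet 1 s₃ t₃ (x A) (x E) (x C) (x F) = 0) :
    (M ⊔ adjoin ℚ {r}).relfinrank ⊤ = 12 := by
  have : CharZero L := algebraRat.charZero L
  have hC : moebius u r (x C) = -moebius u r (x B) := moebius_neg hbc (hden B) (hden C)
  have hF : moebius u r (x F) = -moebius u r (x D) := moebius_neg hdf (hden D) (hden F)
  have k1 := lineDet_moebius (hden _) (hden _) (hden _) (hden _) i1
  have k1' := lineDet_moebius (hden _) (hden _) (hden _) (hden _) i1'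
  have k2 := lineDet_moebius (hden _) (hden _) (hden _) (hden _) i2
  have k2' := lineDet_moebius (hden _) (hden _) (hden _) (hden _) i2'
  have l1 := lineDet_moebius (hden _) (hden _) (hden _) (hden _) j1
  have l2 := lineDet_moebius (hden _) (hden _) (hden _) (hden _) j2
  have l3 := lineDet_moebius (hden _) (hden _) (hden _) (hden _) j3
  rw [hC, hF] at k1 k2 l3
  rw [hF] at k1' k2' l1
  rw [hC] at l2
  have htop : adjoin ℚ (Set.range ![u, r, moebius u r (x A), moebius u r (x B), moebius u r (x D),
      moebius u r (x E)]) = ⊤ := by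
    set G := adjoin ℚ (Set.range ![u, r, moebius u r (x A), moebius u r (x B), moebius u r (x D),
      moebius u r (x E)])
    have hl : ∀ i, ![u, r, moebius u r (x A), moebius u r (x B), moebius u r (x D),
        moebius u r (x E)] i ∈ G := fun i => subset_adjoin _ _ (Set.mem_range_self i)
    have mu : u ∈ G := hl 0
    have mr : r ∈ G := hl 1
    have inv : ∀ p, moebius u r (x p) ∈ G → x p ∈ G := fun p hp => by
      rw [eq_moebius_inv hr (hden p)]
      exact G.add_mem mu (G.div_mem (G.mul_mem mr (G.add_mem G.one_mem hp))
        (G.sub_mem G.one_mem hp))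
    refine hgen G mr ?_
    rintro (_ | _ | _ | _ | _ | _)
    · exact inv _ (hl 2)
    · exact inv _ (hl 3)
    · exact inv _ (hC ▸ G.neg_mem (hl 3))
    · exact inv _ (hl 4)
    · exact inv _ (hl 5)
    · exact inv _ (hF ▸ G.neg_mem (hl 4))
  generalize moebius u r (x A) = a at *
  generalize moebius u r (x B) = b at *
  generalize moebius u r (x D) = d at *
  generalize moebius u r (x E) = e at *
  obtain ⟨hT, hT', hbd, hdet⟩ := generic_hexagon_ne_zero htr htop
  -- Both `ℓ₁` and `ℓ₂` pass through the meet of the chords {b, −b} and {d, −d}, which forces the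
  -- middle coordinate to vanish.
  have b1 : moebiusBeta u r s₁ t₁ = 0 := mul_left_cancel₀ hbd (by
    unfold lineDet at k1
    linear_combination -k1)
  have b2 : moebiusBeta u r s₂ t₂ = 0 := mul_left_cancel₀ hbd (by
    unfold lineDet at k2
    linear_combination k2)
  -- The coordinate used as divisor is nonzero: otherwise genericity would make all three
  -- coordinates of the line vanish.
  have g1 : moebiusGamma u r s₁ t₁ ≠ 0 := fun h => by
    refine moebius_ne_zero hr (mul_left_cancel₀ hT' ?_) b1 h
    unfold lineDet at k1'
    rw [b1, h] at k1'
    linear_combination k1'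
  have g2 : moebiusGamma u r s₂ t₂ ≠ 0 := fun h => by
    refine moebius_ne_zero hr (mul_left_cancel₀ hT ?_) b2 h
    unfold lineDet at k2'
    rw [b2, h] at k2'
    linear_combination -k2'
  have a3 : moebiusAlpha u r s₃ t₃ ≠ 0 := fun h => by
    unfold lineDet at l1 l3
    rw [h] at l1 l3
    refine moebius_ne_zero hr h (mul_left_cancel₀ hdet ?_) (mul_left_cancel₀ hdet ?_)
    · linear_combination ((a + d) * (b * d) + a * d * (b - d)) * l3 +
        ((a + e) * (b * d) + a * e * (b + d)) * l1
    · linear_combination -(b * d + a * d) * l3 - (b * d - a * e) * l1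
  have main := relfinrank_hexagon (u := u) (r := r) (a := a) (b := b) (d := d) (e := e)
    (m₁ := -(moebiusAlpha u r s₁ t₁ / moebiusGamma u r s₁ t₁))
    (m₂ := -(moebiusAlpha u r s₂ t₂ / moebiusGamma u r s₂ t₂))
    (g := moebiusBeta u r s₃ t₃ / moebiusAlpha u r s₃ t₃)
    (h := moebiusGamma u r s₃ t₃ / moebiusAlpha u r s₃ t₃) htr htop
    (by
      unfold lineDet at k1'
      rw [b1] at k1'
      field_simp
      linear_combination -k1')
    (by
      unfold lineDet at k2'
      rw [b2] at k2'
      field_simp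
      linear_combination k2')
    (lineDet_div _ _ _ _ _ _ _ a3 l3) (lineDet_div _ _ _ _ _ _ _ a3 l1) (lineDet_div _ _ _ _ _ _ _ a3 l2)
  set m₁ := -(moebiusAlpha u r s₁ t₁ / moebiusGamma u r s₁ t₁) with hm₁
  set m₂ := -(moebiusAlpha u r s₂ t₂ / moebiusGamma u r s₂ t₂) with hm₂
  set g := moebiusBeta u r s₃ t₃ / moebiusAlpha u r s₃ t₃ with hg
  set h := moebiusGamma u r s₃ t₃ / moebiusAlpha u r s₃ t₃ with hh
  have hMF : M ⊔ adjoin ℚ {r} = adjoin ℚ (Set.range ![u, r, m₁, m₂, g, h]) := by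
    apply le_antisymm
    · set G := adjoin ℚ (Set.range ![u, r, m₁, m₂, g, h])
      have hl : ∀ i, ![u, r, m₁, m₂, g, h] i ∈ G :=
        fun i => subset_adjoin _ _ (Set.mem_range_self i)
      have mu : u ∈ G := hl 0
      have mr : r ∈ G := hl 1
      have q1 := line_mem_of_moebius G hr g1 mu mr
        (by rw [← neg_neg (_ / _), ← hm₁]; exact G.neg_mem (hl 2))
        (by rw [b1, zero_div]; exact G.zero_mem) (by rw [div_self g1]; exact G.one_mem)
      have q2 := line_mem_of_moebius G hr g2 mu mr
        (by rw [← neg_neg (_ / _), ← hm₂]; exact G.neg_mem (hl 3))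
        (by rw [b2, zero_div]; exact G.zero_mem) (by rw [div_self g2]; exact G.one_mem)
      have q3 := line_mem_of_moebius G hr a3 mu mr (by rw [div_self a3]; exact G.one_mem)
        (hl 4) (hl 5)
      exact sup_le (hMle G q1.1 q1.2 q2.1 q2.2 q3.1 q3.2)
        (adjoin_le_iff.mpr (Set.singleton_subset_iff.mpr mr))
    · have mr : r ∈ M ⊔ adjoin ℚ {r} :=
        (le_sup_right : _ ≤ M ⊔ adjoin ℚ {r}) (subset_adjoin _ _ rfl)
      have hle : M ≤ M ⊔ adjoin ℚ {r} := le_sup_left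
      obtain ⟨ms1, mt1, ms2, mt2, ms3, mt3⟩ := hM
      have q1 := moebius_mem_of_line _ (hle hu) mr (hle ms1) (hle mt1)
      have q2 := moebius_mem_of_line _ (hle hu) mr (hle ms2) (hle mt2)
      have q3 := moebius_mem_of_line _ (hle hu) mr (hle ms3) (hle mt3)
      rw [adjoin_le_iff]
      rintro _ ⟨i, rfl⟩
      revert i
      simp only [Fin.forall_fin_succ]
      exact ⟨hle hu, mr, neg_mem (div_mem q1.1 q1.2.2), neg_mem (div_mem q2.1 q2.2.2),
        div_mem q3.2.1 q3.1, div_mem q3.2.2 q3.1, fun i => i.elim0⟩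
  rw [hMF]
  exact main

end ThreePascals

/-! ### Adjoining a square root to the ambient field. -/

section QuadraticExtension

open IntermediateField

theorem exists_quadratic_extension {K : Type} [Field K] {N : K} (hN : ∀ z, z ^ 2 ≠ N) :
    ∃ (L : Type) (_ : Field L) (φ : K →+* L) (r : L), r ^ 2 = φ N ∧
      ∀ z, ∃ p : Polynomial K, p.eval₂ φ r = z := by
  have hirr : Irreducible (Polynomial.X ^ 2 - Polynomial.C N) :=
    X_pow_sub_C_irreducible_of_prime Nat.prime_two hN
  have := Fact.mk hirr
  refine ⟨AdjoinRoot (Polynomial.X ^ 2 - Polynomial.C N), inferInstance, AdjoinRoot.of _,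
    AdjoinRoot.root _, ?_, fun z => ?_⟩
  · have := AdjoinRoot.eval₂_root (Polynomial.X ^ 2 - Polynomial.C N)
    rw [Polynomial.eval₂_sub, Polynomial.eval₂_X_pow, Polynomial.eval₂_C] at this
    exact sub_eq_zero.mp this
  · obtain ⟨p, rfl⟩ := AdjoinRoot.mk_surjective z
    exact ⟨p, (AdjoinRoot.aeval_eq p).symm ▸ rfl⟩

variable {k K L : Type*} [Field k] [Field K] [Field L] [Algebra k K] [Algebra k L]

theorem eq_top_of_eval₂ {φ : K →ₐ[k] L} {r : L}
    (hsurj : ∀ z, ∃ p : Polynomial K, p.eval₂ (φ : K →+* L) r = z) (A : IntermediateField k L)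
    (hr : r ∈ A) (hφ : ∀ z, φ z ∈ A) : A = ⊤ := by
  rw [eq_top_iff]
  rintro z -
  obtain ⟨p, rfl⟩ := hsurj z
  rw [Polynomial.eval₂_eq_sum_range]
  exact sum_mem fun i _ => mul_mem (hφ _) (pow_mem hr i)

theorem mem_sup_adjoin (A : IntermediateField k L) (r : L) : r ∈ A ⊔ adjoin k {r} :=
  (le_sup_right : _ ≤ A ⊔ adjoin k {r}) (subset_adjoin k _ rfl)

/-- Degrees can be computed after a quadratic extension of the ambient field. -/
theorem finrank_eq_of_quadratic_extension {φ : K →ₐ[k] L} {r : L} {N : K} (hr : r ^ 2 = φ N)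
    (hrφ : ∀ z, φ z ≠ r) (hsurj : ∀ z, ∃ p : Polynomial K, p.eval₂ (φ : K →+* L) r = z)
    (M : IntermediateField k K) (hN : N ∈ M) :
    Module.finrank M K = (M.map φ ⊔ adjoin k {r}).relfinrank ⊤ := by
  have key : ∀ M' : IntermediateField k K, N ∈ M' →
      (M'.map φ).relfinrank (M'.map φ ⊔ adjoin k {r}) = 2 := fun M' hM' =>
    relfinrank_sup_adjoin_of_quadratic _ r 0 (-φ N) (zero_mem _) (neg_mem ⟨N, hM', rfl⟩)
      (by rw [← hr]; ring) (fun ⟨z, _, hz⟩ => hrφ z hz)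
  have h1 := key M hN
  have h2 := key ⊤ mem_top
  have htop : (⊤ : IntermediateField k K).map φ ⊔ adjoin k {r} = ⊤ :=
    eq_top_of_eval₂ hsurj _ (mem_sup_adjoin _ r) fun z =>
      (le_sup_left : _ ≤ (⊤ : IntermediateField k K).map φ ⊔ adjoin k {r}) ⟨z, mem_top, rfl⟩
  rw [htop] at h2
  -- L over M is counted in two ways, through K and through M(r); each tower contains one quadratic
  -- step, and the factors 2 cancel.
  have h3 := relfinrank_mul_relfinrank (le_sup_left : M.map φ ≤ M.map φ ⊔ adjoin k {r}) le_top
  have hle : M.map φ ≤ (⊤ : IntermediateField k K).map φ := map_mono φ le_top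
  have h4 := relfinrank_mul_relfinrank hle le_top
  rw [relfinrank_map_map, relfinrank_top_right, h2, ← h3, h1] at h4
  omega

theorem trdeg_of_quadratic_extension {ι : Type*} [Fintype ι] {φ : K →ₐ[k] L} {r : L} {N : K}
    (hr : r ^ 2 = φ N) (hsurj : ∀ z, ∃ p : Polynomial K, p.eval₂ (φ : K →+* L) r = z) {x : ι → K}
    (hx : AlgebraicIndependent k x) (htop : adjoin k (Set.range x) = ⊤) :
    Algebra.trdeg k L = Fintype.card ι := by
  have hx' : AlgebraicIndependent k (φ ∘ x) := hx.map' φ.injective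
  have hφ : ∀ z, φ z ∈ adjoin k (Set.range (φ ∘ x)) := fun z => by
    have hz : z ∈ adjoin k (Set.range x) := htop ▸ mem_top
    have := (adjoin_map k (Set.range x) φ).le ⟨z, hz, rfl⟩
    rwa [← Set.range_comp] at this
  have halg : Algebra.IsAlgebraic (adjoin k (Set.range (φ ∘ x))) L := by
    refine isAlgebraic_of_sup_adjoin_eq_top _ (S := {r}) (fun y hy => ?_)
      (eq_top_of_eval₂ hsurj _ (mem_sup_adjoin _ r) fun z => (le_sup_left : _ ≤
        adjoin k (Set.range (φ ∘ x)) ⊔ adjoin k {r}) (hφ z))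
    rw [Set.mem_singleton_iff.mp hy]
    refine ⟨Polynomial.X ^ 2 - Polynomial.C ⟨φ N, hφ N⟩,
      Polynomial.X_pow_sub_C_ne_zero two_pos _, ?_⟩
    simp only [map_sub, map_pow, Polynomial.aeval_X, Polynomial.aeval_C, hr]
    exact sub_self _
  have h : IsTranscendenceBasis k (φ ∘ x) :=
    isTranscendenceBasis_iff_algebraicIndependent_isAlgebraic.mpr
      ⟨hx', ⟨fun z => isAlgebraic_adjoin_iff.mp (Algebra.IsAlgebraic.isAlgebraic z)⟩⟩
  have := h.lift_cardinalMk_eq_trdeg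
  rw [Cardinal.mk_fintype] at this
  simpa using this.symm

end QuadraticExtension

/-! ### The degree for `ℓ₁`, `ℓ₂`, `ℓ⋆`. -/

section ThreeLinesWithStar

open Letter IntermediateField

theorem map_lineDet {K L F : Type*} [Field K] [Field L] [FunLike F K L] [RingHomClass F K L]
    (φ : F) {s t a b c d : K}
    (h : lineDet 1 s t a b c d = 0) : lineDet 1 (φ s) (φ t) (φ a) (φ b) (φ c) (φ d) = 0 := by
  have := congrArg φ h
  simpa [lineDet] using this

/-- u² − v is the square of r in the involution of the conic centred at [1, u, v]; the last two
equations say that the ends of each chord are paired. -/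
theorem chord_discriminant {K : Type*} [Field K] {a b c d : K} (h : a + b - (c + d) ≠ 0) :
    (chordU a b c d ^ 2 - chordV a b c d) * (a + b - (c + d)) ^ 2 =
      (a - c) * (a - d) * ((b - c) * (b - d)) ∧
    (a - chordU a b c d) * (b - chordU a b c d) = chordU a b c d ^ 2 - chordV a b c d ∧
    (c - chordU a b c d) * (d - chordU a b c d) = chordU a b c d ^ 2 - chordV a b c d := by
  have h1 := chord_left a b c d
  have h2 := chord_right a b c d h
  refine ⟨?_, by linear_combination h1, by linear_combination h2⟩
  unfold chordV chordU
  field_simp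
  ring

/-- If z² were N, then zs would be integral over `R`, hence in `R`, and p would be a square there
with square values. -/
theorem sq_ne_of_mul_sq_eq {R K : Type*} [CommRing R] [IsDomain R] [IsIntegrallyClosed R] [Field K]
    [Algebra R K] [IsFractionRing R K] (ev : R →+* ℚ) (p : R) (hp : ¬ IsSquare (ev p)) {N s : K}
    (h : N * s ^ 2 = algebraMap R K p) (z : K) : z ^ 2 ≠ N := by
  rintro rfl
  have hint : IsIntegral R ((z * s) ^ 2) := by
    rw [mul_pow, h]
    exact isIntegral_algebraMap
  obtain ⟨q, hq⟩ := IsIntegrallyClosed.exists_algebraMap_eq_of_isIntegral_pow two_pos hint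
  have hqp : q ^ 2 = p := IsFractionRing.injective R K (by rw [map_pow, hq, mul_pow, h])
  exact hp ⟨ev q, by rw [← hqp, map_pow, sq]⟩

theorem chord_discriminant_not_square (z : RatFun) :
    z ^ 2 ≠ chordU (coord D) (coord F) (coord B) (coord C) ^ 2 -
      chordV (coord D) (coord F) (coord B) (coord C) := by
  -- At the chosen point the product of differences is 1 · (−3) · 2 · (−2) = 12, not a rational
  -- square.
  refine sq_ne_of_mul_sq_eq (R := MvPolynomial Letter ℚ)
    (MvPolynomial.eval fun | A => 0 | B => 0 | C => 4 | D => 1 | E => 0 | F => 2)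
    ((.X D - .X B) * (.X D - .X C) * ((.X F - .X B) * (.X F - .X C))) ?_
    ((chord_discriminant (coord_chord_sub_ne_zero D F B C (by decide +kernel))).1.trans ?_) z
  · simp only [map_mul, map_sub, MvPolynomial.eval_X]
    norm_num
  · simp only [map_mul, map_sub]
    rfl

theorem line1_incidence :
    lineDet 1 (line1 1) (line1 2) (coord D) (coord F) (coord B) (coord C) = 0 ∧
      lineDet 1 (line1 1) (line1 2) (coord A) (coord F) (coord B) (coord E) = 0 :=
  ⟨lineDet_pascal (M := !![A, D, B; E, C, F]) (by decide) (i := 1) (j := 2) (Or.inr (Or.inl rfl)),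
    lineDet_pascal (M := !![A, D, B; E, C, F]) (by decide) (i := 0) (j := 2) (Or.inr (Or.inr rfl))⟩

theorem line2_incidence :
    lineDet 1 (line2 1) (line2 2) (coord C) (coord B) (coord F) (coord D) = 0 ∧
      lineDet 1 (line2 1) (line2 2) (coord A) (coord B) (coord F) (coord E) = 0 :=
  ⟨lineDet_pascal (M := !![A, C, F; E, D, B]) (by decide) (i := 1) (j := 2) (Or.inr (Or.inl rfl)),
    lineDet_pascal (M := !![A, C, F; E, D, B]) (by decide) (i := 0) (j := 2) (Or.inr (Or.inr rfl))⟩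

theorem lineStar_incidence :
    lineDet 1 (lineStar 1) (lineStar 2) (coord A) (coord D) (coord B) (coord F) = 0 ∧
      lineDet 1 (lineStar 1) (lineStar 2) (coord B) (coord E) (coord C) (coord D) = 0 ∧
      lineDet 1 (lineStar 1) (lineStar 2) (coord A) (coord E) (coord C) (coord F) = 0 :=
  ⟨lineDet_pascal (M := !![A, B, C; F, D, E]) (by decide) (i := 0) (j := 1) (Or.inl rfl),
    lineDet_pascal (M := !![A, B, C; F, D, E]) (by decide) (i := 1) (j := 2) (Or.inr (Or.inl rfl)),
    lineDet_pascal (M := !![A, B, C; F, D, E]) (by decide) (i := 0) (j := 2) (Or.inr (Or.inr rfl))⟩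

theorem chord_mem_line1_line2 {A : IntermediateField ℚ RatFun} (h1 : line1 1 ∈ A ∧ line1 2 ∈ A)
    (h2 : line2 1 ∈ A ∧ line2 2 ∈ A) :
    chordU (coord D) (coord F) (coord B) (coord C) ∈ A ∧
      chordV (coord D) (coord F) (coord B) (coord C) ∈ A :=
  chord_mem (M := !![Letter.A, D, B; E, C, F]) (M' := !![Letter.A, C, F; E, D, B])
    (p := D) (q := F) (r := B) (s := C) A h1 h2 (by decide +kernel)
    (by decide +kernel) (by decide +kernel) (by decide +kernel)
    line1_incidence.1 (lineDet_reverse line2_incidence.1)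

theorem finrank_fieldOf_of_quadratic_extension {L : Type*} [Field L] [Algebra ℚ L]
    (φ : RatFun →ₐ[ℚ] L) {r : L}
    (hr : r ^ 2 = φ (chordU (coord D) (coord F) (coord B) (coord C) ^ 2 -
      chordV (coord D) (coord F) (coord B) (coord C)))
    (hsurj : ∀ z, ∃ p : Polynomial RatFun, p.eval₂ (φ : RatFun →+* L) r = z) :
    Module.finrank (fieldOf {line1, line2, lineStar}) RatFun = 12 := by
  have m1 := coord_mem_fieldOf (X := {line1, line2, lineStar}) (l := line1) (by simp)
  have m2 := coord_mem_fieldOf (X := {line1, line2, lineStar}) (l := line2) (by simp)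
  have m3 := coord_mem_fieldOf (X := {line1, line2, lineStar}) (l := lineStar) (by simp)
  have p1 := chord_mem_line1_line2 m1 m2
  obtain ⟨-, hdf, hbc⟩ := chord_discriminant
    (coord_chord_sub_ne_zero D F B C (by decide +kernel))
  have hnsq := chord_discriminant_not_square
  obtain ⟨i1, i1'⟩ := line1_incidence
  obtain ⟨i2, i2'⟩ := line2_incidence
  obtain ⟨j1, j2, j3⟩ := lineStar_incidence
  have hN := sub_mem (pow_mem p1.1 2) p1.2
  generalize chordV (coord D) (coord F) (coord B) (coord C) = v at *
  generalize chordU (coord D) (coord F) (coord B) (coord C) = u at *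
  have hrφ : ∀ z, φ z ≠ r := fun z hz =>
    hnsq z (φ.injective ((map_pow φ z 2).trans ((congrArg (· ^ 2) hz).trans hr)))
  have htop : adjoin ℚ (Set.range coord) = ⊤ :=
    eq_top_of_coord_mem _ fun p => subset_adjoin ℚ _ (Set.mem_range_self p)
  have htr : Algebra.trdeg ℚ L = 6 :=
    (trdeg_of_quadratic_extension hr hsurj algebraicIndependent_coord htop).trans rfl
  have hmem : ∀ {z : RatFun}, z ∈ fieldOf {line1, line2, lineStar} →
      φ z ∈ (fieldOf {line1, line2, lineStar}).map φ := fun hz => ⟨_, hz, rfl⟩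
  rw [finrank_eq_of_quadratic_extension hr hrφ hsurj _ hN]
  refine relfinrank_three_pascals htr (x := fun p => φ (coord p)) (u := φ u) ?_ ?_ ?_ ?_ ?_ _
    (hmem p1.1) ⟨hmem m1.1, hmem m1.2, hmem m2.1, hmem m2.2, hmem m3.1, hmem m3.2⟩ ?_
    (map_lineDet φ i1) (map_lineDet φ i1') (map_lineDet φ i2) (map_lineDet φ i2')
    (map_lineDet φ j1) (map_lineDet φ j2) (map_lineDet φ j3)
  · rintro rfl
    exact hrφ 0 (map_zero φ)
  -- A vanishing denominator would give r = u − x p, an element of the original field.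
  · intro p h
    refine hrφ (u - coord p) ?_
    rw [map_sub]
    linear_combination -h
  · rw [hr, ← map_sub, ← map_sub, ← map_mul, hbc]
  · rw [hr, ← map_sub, ← map_sub, ← map_mul, hdf]
  · intro G hG hx
    refine eq_top_of_eval₂ hsurj G hG fun z => ?_
    have : G.comap φ = ⊤ := eq_top_of_coord_mem _ hx
    exact (this.ge mem_top : z ∈ G.comap φ)
  · intro G a1 a2 a3 a4 a5 a6
    refine map_le_iff_le_comap.mpr (adjoin_le_iff.mpr ?_)
    rintro y ⟨l, hl, hy⟩
    have : φ (l 1) ∈ G ∧ φ (l 2) ∈ G := by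
      rcases hl with rfl | rfl | rfl
      · exact ⟨a1, a2⟩
      · exact ⟨a3, a4⟩
      · exact ⟨a5, a6⟩
    rcases hy with rfl | rfl
    · exact this.1
    · exact this.2

theorem finrank_fieldOf_line1_line2_lineStar :
    Module.finrank (fieldOf {line1, line2, lineStar}) RatFun = 12 := by
  obtain ⟨L, _, φ, r, hr, hsurj⟩ := exists_quadratic_extension chord_discriminant_not_square
  have : CharZero L := charZero_of_injective_ringHom φ.injective
  exact finrank_fieldOf_of_quadratic_extension φ.toRatAlgHom hr hsurj

end ThreeLinesWithStar

/-! ### The cyclic symmetry, and optimality. -/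

section Symmetry

open Letter IntermediateField

/-- The action of a permutation of the letters on lines. -/
noncomputable def permuteLine (e : Equiv.Perm Letter) (l : Fin 3 → RatFun) : Fin 3 → RatFun :=
  fun k => permute e (l k)

theorem permuteLine_pascal (e : Equiv.Perm Letter) (M : Matrix (Fin 2) (Fin 3) Letter) :
    permuteLine e (pascal M) = pascal (M.map e) :=
  funext (permute_pascal e M)

theorem finrank_fieldOf_permute (e : Equiv.Perm Letter) (X : Set (Fin 3 → RatFun)) :
    Module.finrank (fieldOf (permuteLine e '' X)) RatFun = Module.finrank (fieldOf X) RatFun := by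
  have h : fieldOf (permuteLine e '' X) = (fieldOf X).map (permute e).toAlgHom := by
    unfold fieldOf
    rw [adjoin_map]
    congr 1
    ext y
    constructor
    · rintro ⟨_, ⟨l, hl, rfl⟩, rfl | rfl⟩
      · exact ⟨_, ⟨l, hl, Or.inl rfl⟩, rfl⟩
      · exact ⟨_, ⟨l, hl, Or.inr rfl⟩, rfl⟩
    · rintro ⟨_, ⟨l, hl, rfl | rfl⟩, rfl⟩
      · exact ⟨_, ⟨l, hl, rfl⟩, Or.inl rfl⟩
      · exact ⟨_, ⟨l, hl, rfl⟩, Or.inr rfl⟩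
  have htop : (⊤ : IntermediateField ℚ RatFun).map (permute e).toAlgHom = ⊤ := by
    rw [eq_top_iff]
    rintro z -
    exact ⟨(permute e).symm z, mem_top, (permute e).apply_symm_apply z⟩
  rw [← relfinrank_top_right, h, ← htop, relfinrank_map_map, relfinrank_top_right]

/-- The permutation of the letters that permutes `ℓ₁`, `ℓ₂`, `ℓ₃` cyclically and fixes `ℓ⋆`. -/
def rotation : Equiv.Perm Letter :=
  Equiv.swap A B * Equiv.swap A C * (Equiv.swap D E * Equiv.swap D F)

/-- Here and in the next three lemmas, the image array agrees with the target up to a cyclic shift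
of columns and, for the images of `ℓ₂` and `ℓ₃`, an interchange of rows; neither changes the Pascal.
-/
theorem permuteLine_line1 : permuteLine rotation line1 = line2 :=
  (permuteLine_pascal _ _).trans (pascal_shift (by decide) (by decide)
    fun i j => by fin_cases i <;> fin_cases j <;> rfl)

theorem permuteLine_line2 : permuteLine rotation line2 = line3 :=
  (permuteLine_pascal _ _).trans ((pascal_swap_rows (M := !![D, F, A; C, B, E]) (by decide)
    (by decide)).trans (pascal_shift (by decide) (by decide)
    fun i j => by fin_cases i <;> fin_cases j <;> rfl))

theorem permuteLine_line3 : permuteLine rotation line3 = line1 :=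
  (permuteLine_pascal _ _).trans ((pascal_swap_rows (M := !![D, B, A; C, F, E]) (by decide)
    (by decide)).trans (pascal_shift (by decide) (by decide)
    fun i j => by fin_cases i <;> fin_cases j <;> rfl))

theorem permuteLine_lineStar : permuteLine rotation lineStar = lineStar :=
  (permuteLine_pascal _ _).trans (pascal_shift (by decide) (by decide)
    fun i j => by fin_cases i <;> fin_cases j <;> rfl).symm

theorem finrank_fieldOf_line2_line3_lineStar :
    Module.finrank (fieldOf {line2, line3, lineStar}) RatFun = 12 := by
  have h := finrank_fieldOf_permute rotation {line1, line2, lineStar}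
  rwa [Set.image_insert_eq, Set.image_pair, permuteLine_line1, permuteLine_line2,
    permuteLine_lineStar, finrank_fieldOf_line1_line2_lineStar] at h

theorem finrank_fieldOf_line1_line3_lineStar :
    Module.finrank (fieldOf {line1, line3, lineStar}) RatFun = 12 := by
  have h := finrank_fieldOf_permute rotation {line2, line3, lineStar}
  rwa [Set.image_insert_eq, Set.image_pair, permuteLine_line2, permuteLine_line3,
    permuteLine_lineStar, finrank_fieldOf_line2_line3_lineStar, Set.insert_comm] at h

end Symmetry

theorem not_isAdequate_of_subset {X Y : Set (Fin 3 → RatFun)} (hYX : Y ⊆ X)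
    (h : Module.finrank (fieldOf X) RatFun ≠ 1) : ¬ IsAdequate Y := fun hY => h (by
  have hX : fieldOf X = ⊤ := top_le_iff.mp (le_of_eq_of_le hY.symm (fieldOf_mono hYX))
  rw [← IntermediateField.relfinrank_top_right, hX, IntermediateField.relfinrank_self])

/-- A proper subset omits one of the lines, so it lies in one of the four triples, whose fields have
index 2 or 12. -/
theorem isOptimal_four_lines : IsOptimal {line1, line2, line3, lineStar} := by
  refine ⟨isAdequate_four_lines, fun Y hY => ?_⟩
  obtain ⟨l, hl, hlY⟩ := Set.exists_of_ssubset hY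
  have key : ∀ l' ∈ Y, l' ≠ l ∧ (l' = line1 ∨ l' = line2 ∨ l' = line3 ∨ l' = lineStar) :=
    fun l' hl' => ⟨fun e => hlY (e ▸ hl'), hY.1 hl'⟩
  rcases hl with rfl | rfl | rfl | rfl
  · exact not_isAdequate_of_subset (X := {line2, line3, lineStar})
      (fun l' hl' => (key l' hl').2.resolve_left (key l' hl').1)
      (by rw [finrank_fieldOf_line2_line3_lineStar]; norm_num)
  · refine not_isAdequate_of_subset (X := {line1, line3, lineStar}) (fun l' hl' => ?_)
      (by rw [finrank_fieldOf_line1_line3_lineStar]; norm_num)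
    obtain ⟨hne, h | h | h⟩ := key l' hl'
    · exact Or.inl h
    · exact absurd h hne
    · exact Or.inr h
  · refine not_isAdequate_of_subset (X := {line1, line2, lineStar}) (fun l' hl' => ?_)
      (by rw [finrank_fieldOf_line1_line2_lineStar]; norm_num)
    obtain ⟨hne, h | h | h | h⟩ := key l' hl'
    · exact Or.inl h
    · exact Or.inr (Or.inl h)
    · exact absurd h hne
    · exact Or.inr (Or.inr h)
  · refine not_isAdequate_of_subset (X := {line1, line2, line3}) (fun l' hl' => ?_)
      (by rw [finrank_three_lines]; norm_num)
    obtain ⟨hne, h | h | h | h⟩ := key l' hl'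
    · exact Or.inl h
    · exact Or.inr (Or.inl h)
    · exact Or.inr (Or.inr h)
    · exact absurd h hne

end PascalHexagram

theorem mainTheorem5 :
    PascalHexagram.IsOptimal {PascalHexagram.line1, PascalHexagram.line2, PascalHexagram.line3,
        PascalHexagram.lineStar} ∧
      Module.finrank (PascalHexagram.fieldOf {PascalHexagram.line1, PascalHexagram.line2,
        PascalHexagram.line3}) PascalHexagram.RatFun = 2 ∧
      Module.finrank (PascalHexagram.fieldOf {PascalHexagram.line1, PascalHexagram.line2,
        PascalHexagram.lineStar}) PascalHexagram.RatFun = 12 ∧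
      Module.finrank (PascalHexagram.fieldOf {PascalHexagram.line1, PascalHexagram.line3,
        PascalHexagram.lineStar}) PascalHexagram.RatFun = 12 ∧
      Module.finrank (PascalHexagram.fieldOf {PascalHexagram.line2, PascalHexagram.line3,
        PascalHexagram.lineStar}) PascalHexagram.RatFun = 12 :=
  ⟨PascalHexagram.isOptimal_four_lines, PascalHexagram.finrank_three_lines,
    PascalHexagram.finrank_fieldOf_line1_line2_lineStar,
    PascalHexagram.finrank_fieldOf_line1_line3_lineStar,
    PascalHexagram.finrank_fieldOf_line2_line3_lineStar⟩
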